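/- **Notation.** For a register of qubits, $X_i,Z_i$ are the Pauli operators on qubit $i$, $\|\cdot\|$ is the operator norm, and the spectral gap of a Hermitian matrix is its second smallest minus its smallest eigenvalue (with multiplicity). $A_0\longrightarrow A_1\longrightarrow\cdots\longrightarrow A_k$ denotes the piecewise linear path through these matrices; its spectral gap and norm are the infimum of the gaps and the supremum of the norms along it. A Hamiltonian is called TFI (transverse field Ising) if, up to an additive multiple of the identity, it has the form $\sum_u (h_uX_u+g_uZ_u)+\sum_{u<v}g_{u,v}Z_uZ_v$ with real coefficients. Let $n_B,\ell\ge 1$ be integers and $m,\Delta_B$ reals with $1\le m\le\Delta_B$, and put $X_B=-\Delta_B\sum_{i=1}^{n_B}X_i$ on $n_B$ qubits. Given real diagonal $n_B$-qubit Hamiltonians $D_0,\dots,D_\ell$, consider the path $$X_B+D_0\longrightarrow X_B+D_1\longrightarrow\cdots\longrightarrow X_B+D_\ell .\qquad(1)$$ On $\ell$ further (clock) qubits let $|\mathbf j\rangle=|1^j0^{\ell-j}\rangle$ for $0\le j\le \ell$, and, for parameters $\epsilon_L,\Delta_L,\Delta_C,\eta>0$, $$X_L=-\sum_{i=1}^{\ell}X_i,\quad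 Q_L=\Delta_L\Big((\ell-1)I+Z_1-Z_\ell-\sum_{i=1}^{\ell-1}Z_iZ_{i+1}\Big),\quad Z_L(t)=\frac1{\epsilon_L}\sum_{i=1}^{\ell}(i-t)(I-Z_i),$$ $$D_C=\sum_{j=0}^{\ell}D_j\otimes|\mathbf j\rangle\langle\mathbf j|,$$ $$H_C'(t)=\Delta_C\, I\otimes\big(Q_L+(1-t\eta)X_L+Z_L(t)\big)+(1-t\eta)\,X_B\otimes I+(1+t\eta)\,D_C .$$ **Lemma 4.9.** For every $c>0$ there is $c'>0$ such that for every polynomial $P$ with non-negative integer coefficients there is such a polynomial $Q$ with the following property. Let $N\ge1$ be an integer and let $m,\Delta_B,n_B,\ell$ be as above with $\Delta_B,n_B,\ell\le P(N)$. Then there are parameters $$\tfrac1{Q(N)}\le\epsilon_L\le1,\qquad 0<\Delta_L\le Q(N),\qquad \Delta_C\le Q(N),\qquad \eta\ge\tfrac1{Q(N)}$$ such that for all $u\in\{0,1\}^{n_B}$ and all real diagonal $D_0,\dots,D_\ell$ with $D_0=0$ and $D_\ell=-3\Delta_Bn_B|u\rangle\langle u|$ for which the path (1) has spectral gap at least $c\sqrt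 m$ and norm at most $P(N)$, we have: 1. $10\|D_C\|\le\Delta_C$ and $\eta\le 1/(10\|D_C\|+\ell)$; 2. $H_C'(-1/\eta)$ is a TFI Hamiltonian and $H_C'(1/\eta)$ is diagonal; 3. for every $t\in\mathbb R$ and $0\le j\le\ell$, the diagonal block of $H_C'(t)$ at the clock state $|\mathbf j\rangle$ is $$(I\otimes\langle\mathbf j|)\,H_C'(t)\,(I\otimes|\mathbf j\rangle)=\frac{\Delta_C\,j(j+1-2t)}{\epsilon_L}\,I+(1-t\eta)X_B+(1+t\eta)D_j ,$$ so that $H_C'$ carries the nodes of (1) on the clock states; 4. the path $H_C'(-1/\eta)\longrightarrow H_C'(1/\eta)$ has spectral gap at least $c'\sqrt m$ and norm at most $Q(N)$. -/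

import Mathlib

open scoped Kronecker

noncomputable section

namespace TiltedPath

/-! ### Qubits, Pauli operators, spectral gap and norm -/

/-- Computational basis states of a register whose qubits are labelled by `V`. -/
abbrev Bits (V : Type) : Type := V → Bool

/-- Operators on the register `V`, written in the computational basis. -/
abbrev Op (V : Type) : Type := Matrix (Bits V) (Bits V) ℂ

/-- The Pauli operator `X` on qubit `u` (it flips the bit `u`). -/
def pauliX {V : Type} [Fintype V] [DecidableEq V] (u : V) : Op V :=
  Matrix.of fun x y => if y = Function.update x u (!(x u)) then 1 else 0

/-- The Pauli operator `Z` on qubit `u`. -/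
def pauliZ {V : Type} [Fintype V] [DecidableEq V] (u : V) : Op V :=
  Matrix.diagonal fun x => if x u then -1 else 1

/-- The operator norm induced by the Euclidean norm. -/
def opNorm {ι : Type} [Fintype ι] [DecidableEq ι] (H : Matrix ι ι ℂ) : ℝ :=
  ‖Matrix.toEuclideanCLM (n := ι) (𝕜 := ℂ) H‖

/-- The spectral gap of a Hermitian matrix of size at least two: the second smallest minus the
smallest eigenvalue, counted with multiplicity (Mathlib lists the eigenvalues in decreasing order).
It is set to `0` for other matrices. -/
def spectralGap {ι : Type} [Fintype ι] [DecidableEq ι] (H : Matrix ι ι ℂ) : ℝ :=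
  if h : H.IsHermitian ∧ 2 ≤ Fintype.card ι then
    h.1.eigenvalues₀ ⟨Fintype.card ι - 2, by omega⟩
      - h.1.eigenvalues₀ ⟨Fintype.card ι - 1, by omega⟩
  else 0

/-- `H` is a transverse field Ising Hamiltonian up to an energy shift `e`: a real combination of
the `X u`, the `Z u`, the products `Z u * Z v` with `u ≠ v`, and the identity. -/
def IsTFI {V : Type} [Fintype V] [DecidableEq V] (H : Op V) : Prop :=
  ∃ (e : ℝ) (h g : V → ℝ) (J : V → V → ℝ),
    H = e • (1 : Op V) + ∑ u, (h u • pauliX u + g u • pauliZ u)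
      + ∑ u, ∑ v ∈ Finset.univ.filter (fun v => v ≠ u), J u v • (pauliZ u * pauliZ v)

/-! ### Hamiltonian paths -/

/-- The piecewise linear path `H 0 ⟶ H 1 ⟶ ⋯ ⟶ H ℓ`, parametrised by `s ∈ [0,1]`.
(At `s = 1` the second summand has weight zero.) -/
def piecewiseLinear {ℓ : ℕ} {E : Type} [AddCommGroup E] [Module ℝ E]
    (H : Fin (ℓ + 1) → E) (s : ℝ) : E :=
  (1 - Int.fract (ℓ * s)) • H (Fin.clamp ⌊ℓ * s⌋₊ ℓ)
    + Int.fract (ℓ * s) • H (Fin.clamp (⌊ℓ * s⌋₊ + 1) ℓ)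

/-- The infimum over `s ∈ [0,1]` of the spectral gap of `H s` is at least `δ`. -/
def PathGapGE {ι : Type} [Fintype ι] [DecidableEq ι] (H : ℝ → Matrix ι ι ℂ) (δ : ℝ) : Prop :=
  ∀ s ∈ Set.Icc (0 : ℝ) 1, δ ≤ spectralGap (H s)

/-- The supremum over `s ∈ [0,1]` of the operator norm of `H s` is at most `B`. -/
def PathNormLE {ι : Type} [Fintype ι] [DecidableEq ι] (H : ℝ → Matrix ι ι ℂ) (B : ℝ) : Prop :=
  ∀ s ∈ Set.Icc (0 : ℝ) 1, opNorm (H s) ≤ B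

/-! ### The piecewise linear path that is to be linearized -/

/-- The transverse field `X_B = -Δ_B ∑ i, X i`. -/
def XB (nB : ℕ) (ΔB : ℝ) : Op (Fin nB) := -(ΔB • ∑ i : Fin nB, pauliX i)

/-- The piecewise linear path `X_B + D 0 ⟶ X_B + D 1 ⟶ ⋯ ⟶ X_B + D ℓ`. -/
def basePath {nB ℓ : ℕ} (ΔB : ℝ) (D : Fin (ℓ + 1) → Op (Fin nB)) : ℝ → Op (Fin nB) :=
  piecewiseLinear fun i => XB nB ΔB + D i

/-! ### The clock register -/

/-- The unary clock state `1^j 0^(ℓ-j)`. -/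
def clock (ℓ : ℕ) (j : Fin (ℓ + 1)) : Bits (Fin ℓ) := fun i => decide ((i : ℕ) < (j : ℕ))

/-- `X_L = -∑ i, X i`. -/
def XL (ℓ : ℕ) : Op (Fin ℓ) := -∑ i : Fin ℓ, pauliX i

/-- `Q_L = Δ_L ((ℓ-1) I + Z_1 - Z_ℓ - ∑_{1 ≤ i ≤ ℓ-1} Z_i Z_{i+1})`; qubit number `i` is the
element `i - 1` of `Fin ℓ`, so `Z_1` and `Z_ℓ` are at `0` and `Fin.rev 0`. -/
def QL (ℓ : ℕ) [NeZero ℓ] (ΔL : ℝ) : Op (Fin ℓ) :=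
  ΔL • (((ℓ : ℝ) - 1) • (1 : Op (Fin ℓ)) + pauliZ (0 : Fin ℓ) - pauliZ (Fin.rev (0 : Fin ℓ))
    - ∑ i : Fin (ℓ - 1), pauliZ (⟨(i : ℕ), by omega⟩ : Fin ℓ)
        * pauliZ (⟨(i : ℕ) + 1, by omega⟩ : Fin ℓ))

/-- `Z_L(t) = ε_L⁻¹ ∑_{1 ≤ i ≤ ℓ} (i - t) (I - Z_i)`. -/
def ZL (ℓ : ℕ) (εL t : ℝ) : Op (Fin ℓ) :=
  (1 / εL) • ∑ i : Fin ℓ, (((i : ℕ) : ℝ) + 1 - t) • (1 - pauliZ i)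

/-! ### The tilted and extended path -/

/-- `D_C = ∑_{0 ≤ i ≤ ℓ} D_i ⊗ |i⟩⟨i|`, with the clock states `|i⟩`. -/
def DC {nB ℓ : ℕ} (D : Fin (ℓ + 1) → Op (Fin nB)) :
    Matrix (Bits (Fin nB) × Bits (Fin ℓ)) (Bits (Fin nB) × Bits (Fin ℓ)) ℂ :=
  ∑ i : Fin (ℓ + 1), D i ⊗ₖ Matrix.single (clock ℓ i) (clock ℓ i) (1 : ℂ)

/-- `H_C'(t) = Δ_C I ⊗ (Q_L + (1 - tη) X_L + Z_L(t)) + (1 - tη) X_B ⊗ I + (1 + tη) D_C`. -/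
def HC' {nB ℓ : ℕ} [NeZero ℓ] (ΔB : ℝ) (D : Fin (ℓ + 1) → Op (Fin nB)) (εL ΔL ΔC η t : ℝ) :
    Matrix (Bits (Fin nB) × Bits (Fin ℓ)) (Bits (Fin nB) × Bits (Fin ℓ)) ℂ :=
  ΔC • ((1 : Op (Fin nB)) ⊗ₖ (QL ℓ ΔL + (1 - t * η) • XL ℓ + ZL ℓ εL t))
    + (1 - t * η) • (XB nB ΔB ⊗ₖ (1 : Op (Fin ℓ)))
    + (1 + t * η) • DC D

/-- The linear path `H_C'(-1/η) ⟶ H_C'(1/η)`. -/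
def tiltedPath {nB ℓ : ℕ} [NeZero ℓ] (ΔB : ℝ) (D : Fin (ℓ + 1) → Op (Fin nB))
    (εL ΔL ΔC η : ℝ) :
    ℝ → Matrix (Bits (Fin nB) × Bits (Fin ℓ)) (Bits (Fin nB) × Bits (Fin ℓ)) ℂ :=
  piecewiseLinear (ℓ := 1) ![HC' ΔB D εL ΔL ΔC η (-1 / η), HC' ΔB D εL ΔL ΔC η (1 / η)]

/-- An operator on two registers, seen as an operator on their joint register. -/
def joinRegisters {V W : Type} (H : Matrix (Bits V × Bits W) (Bits V × Bits W) ℂ) : Op (V ⊕ W) :=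
  H.submatrix (Equiv.sumArrowEquivProdArrow V W Bool) (Equiv.sumArrowEquivProdArrow V W Bool)

end TiltedPath

end

open TiltedPath

/-! Write $H_C'(t)=\Delta_C\,I\otimes C(t)+B(t)$, with $C(t)$ the clock Hamiltonian and
$B(t)=(1-t\eta)X_B\otimes I+(1+t\eta)D_C$. The clock has a gap of at least $1/2$ at every $t$, so a
large $\Delta_C$ freezes it in its ground state $\varphi$, and the gap of $H_C'(t)$ is at least half
of the gap guaranteed for the effective Hamiltonian $(1-t\eta)X_B+(1+t\eta)\sum_j|\varphi(\mathbf
j)|^2D_j$ (`half_le_spectralGap_of_frozen`, `half_le_spectralGap_of_near`).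

The clock (`exists_clock_ground`): $Q_L$ penalizes every string that is not a clock state, and the
tilt gives $|\mathbf j\rangle$ the energy $j(j+1-2t)/\epsilon_L$, whose levels $j$ and $j+1$ cross
at $t=j+1$. Hence either one end state is isolated at the bottom, or two consecutive clock states
are; in the second case the transverse field, of strength at least $1/2$ there, splits them. Outside
these one or two states $\varphi$ has weight $O(\ell\epsilon_L)$.

The effective Hamiltonian (`le_spectralGap_HC'`) is then close to one with a known gap. For $t\le
1/2$ this is $(1-t\eta)X_B$, because $D_0=0$. For $1/2\le t\le\ell+1/2$ it is a point of the path
(1), because $t\eta$ is tiny. For larger $t$ it is $(1-t\eta)X_B+(1+t\eta)D_\ell$, where the well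
$D_\ell$ is deep enough to dominate any remaining field.

All gap bounds are variational: `le_spectralGap` needs only a trial vector and an energy bound on
its orthogonal complement. -/

noncomputable section

namespace TiltedPath

/-! ### Quadratic forms, operator norms and variational bounds on the spectral gap -/

variable {ι : Type} [Fintype ι] [DecidableEq ι]

/-- The expectation value `⟨x, H x⟩` of a Hermitian matrix. -/
def energy (H : Matrix ι ι ℂ) (x : EuclideanSpace ℂ ι) : ℝ :=
  (inner ℂ x (Matrix.toEuclideanCLM (n := ι) (𝕜 := ℂ) H x)).re

lemma energy_add (A B : Matrix ι ι ℂ) (x : EuclideanSpace ℂ ι) :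
    energy (A + B) x = energy A x + energy B x := by
  simp [energy]

lemma energy_sub (A B : Matrix ι ι ℂ) (x : EuclideanSpace ℂ ι) :
    energy (A - B) x = energy A x - energy B x := by
  simp [energy]

lemma toEuclideanCLM_real_smul (r : ℝ) (A : Matrix ι ι ℂ) :
    Matrix.toEuclideanCLM (n := ι) (𝕜 := ℂ) (r • A)
      = (r : ℂ) • Matrix.toEuclideanCLM (n := ι) (𝕜 := ℂ) A := by
  rw [← map_smul]; rfl

lemma energy_smul (r : ℝ) (A : Matrix ι ι ℂ) (x : EuclideanSpace ℂ ι) :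
    energy (r • A) x = r * energy A x := by
  simp [energy, toEuclideanCLM_real_smul]

lemma energy_sum {κ : Type} (s : Finset κ) (A : κ → Matrix ι ι ℂ) (x : EuclideanSpace ℂ ι) :
    energy (∑ k ∈ s, A k) x = ∑ k ∈ s, energy (A k) x := by
  simp [energy, map_sum]

lemma opNorm_nonneg (A : Matrix ι ι ℂ) : 0 ≤ opNorm A := norm_nonneg _

lemma opNorm_add_le (A B : Matrix ι ι ℂ) : opNorm (A + B) ≤ opNorm A + opNorm B := by
  simpa [opNorm] using norm_add_le (Matrix.toEuclideanCLM (n := ι) (𝕜 := ℂ) A) _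

lemma opNorm_sub_le (A B : Matrix ι ι ℂ) : opNorm (A - B) ≤ opNorm A + opNorm B := by
  simpa [opNorm] using norm_sub_le (Matrix.toEuclideanCLM (n := ι) (𝕜 := ℂ) A) _

lemma opNorm_neg (A : Matrix ι ι ℂ) : opNorm (-A) = opNorm A := by
  simp [opNorm]

lemma opNorm_smul (r : ℝ) (A : Matrix ι ι ℂ) : opNorm (r • A) = |r| * opNorm A := by
  simp [opNorm, toEuclideanCLM_real_smul, norm_smul]

lemma opNorm_sum_le {κ : Type} (s : Finset κ) (A : κ → Matrix ι ι ℂ) :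
    opNorm (∑ k ∈ s, A k) ≤ ∑ k ∈ s, opNorm (A k) := by
  simpa [opNorm, map_sum] using norm_sum_le s _

lemma norm_inner_le_opNorm (A : Matrix ι ι ℂ) (x y : EuclideanSpace ℂ ι) :
    ‖inner ℂ x (Matrix.toEuclideanCLM (n := ι) (𝕜 := ℂ) A y)‖ ≤ opNorm A * ‖x‖ * ‖y‖ := by
  refine (norm_inner_le_norm _ _).trans ?_
  have := (Matrix.toEuclideanCLM (n := ι) (𝕜 := ℂ) A).le_opNorm y
  calc _ ≤ ‖x‖ * (opNorm A * ‖y‖) := mul_le_mul_of_nonneg_left this (norm_nonneg _)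
    _ = _ := by ring

lemma abs_energy_le (A : Matrix ι ι ℂ) (x : EuclideanSpace ℂ ι) :
    |energy A x| ≤ opNorm A * ‖x‖ ^ 2 := by
  refine (Complex.abs_re_le_norm _).trans ((norm_inner_le_opNorm A x x).trans_eq ?_)
  ring

lemma energy_add_vec_ge (A : Matrix ι ι ℂ) (y z : EuclideanSpace ℂ ι) :
    energy A y - 2 * opNorm A * ‖y‖ * ‖z‖ - opNorm A * ‖z‖ ^ 2 ≤ energy A (y + z) := by
  have h1 := (Complex.abs_re_le_norm _).trans (norm_inner_le_opNorm A y z)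
  have h2 := (Complex.abs_re_le_norm _).trans (norm_inner_le_opNorm A z y)
  have h3 := abs_energy_le A z
  have e : energy A (y + z) = energy A y + energy A z
      + (inner ℂ y (Matrix.toEuclideanCLM (n := ι) (𝕜 := ℂ) A z)).re
      + (inner ℂ z (Matrix.toEuclideanCLM (n := ι) (𝕜 := ℂ) A y)).re := by
    simp [energy]; ring
  rw [abs_le] at h1 h2 h3
  nlinarith

lemma toEuclideanCLM_eigenvectorBasis {H : Matrix ι ι ℂ} (hH : H.IsHermitian) (j : ι) :
    Matrix.toEuclideanCLM (n := ι) (𝕜 := ℂ) H (hH.eigenvectorBasis j)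
      = (hH.eigenvalues j : ℂ) • hH.eigenvectorBasis j := by
  apply (WithLp.equiv 2 _).injective
  have := hH.mulVec_eigenvectorBasis j
  simpa using! this

lemma energy_eq_sum_eigenvalues {H : Matrix ι ι ℂ} (hH : H.IsHermitian)
    (x : EuclideanSpace ℂ ι) :
    energy H x = ∑ j, hH.eigenvalues j * ‖inner ℂ (hH.eigenvectorBasis j) x‖ ^ 2 := by
  have key : Matrix.toEuclideanCLM (n := ι) (𝕜 := ℂ) H x
      = ∑ j, (hH.eigenvalues j * inner ℂ (hH.eigenvectorBasis j) x) • hH.eigenvectorBasis j := by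
    conv_lhs => rw [← hH.eigenvectorBasis.sum_repr' x]
    simp only [map_sum, map_smul, toEuclideanCLM_eigenvectorBasis, smul_smul]
    exact Finset.sum_congr rfl fun j _ => by rw [mul_comm]
  rw [energy, key, inner_sum, Complex.re_sum]
  refine Finset.sum_congr rfl fun j _ => ?_
  rw [inner_smul_right, mul_assoc, ← inner_conj_symm, ← Complex.normSq_eq_conj_mul_self]
  rw [← inner_conj_symm, Complex.normSq_conj, Complex.normSq_eq_norm_sq]
  norm_cast
  simp

lemma spectralGap_eq_sub {H : Matrix ι ι ℂ} (hH : H.IsHermitian) (hc : 2 ≤ Fintype.card ι) :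
    ∃ i₁ i₂ : ι, i₁ ≠ i₂ ∧ spectralGap H = hH.eigenvalues i₂ - hH.eigenvalues i₁ ∧
      (∀ j, hH.eigenvalues i₁ ≤ hH.eigenvalues j) ∧
      (∀ j, j ≠ i₁ → hH.eigenvalues i₂ ≤ hH.eigenvalues j) := by
  set e := Fintype.equivOfCardEq (Fintype.card_fin (Fintype.card ι)) with he
  have hev : ∀ j, hH.eigenvalues j = hH.eigenvalues₀ (e.symm j) := fun j => rfl
  refine ⟨e ⟨Fintype.card ι - 1, by omega⟩, e ⟨Fintype.card ι - 2, by omega⟩, ?_, ?_, ?_, ?_⟩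
  · intro h
    have := congrArg Fin.val (e.injective h)
    simp at this; omega
  · rw [spectralGap, dif_pos ⟨hH, hc⟩]
    simp [hev]
  · intro j
    rw [hev, hev, Equiv.symm_apply_apply]
    apply hH.eigenvalues₀_antitone
    rw [Fin.le_def]; have := (e.symm j).2; simp; omega
  · intro j hj
    rw [hev, hev, Equiv.symm_apply_apply]
    apply hH.eigenvalues₀_antitone
    rw [Fin.le_def]; have := (e.symm j).2
    have h2 : (e.symm j).1 ≠ Fintype.card ι - 1 := by
      intro h
      apply hj
      rw [← e.apply_symm_apply j]
      congr 1
      exact Fin.ext h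
    simp; omega

/-- The spectral gap is at least `δ` when the energy on the orthogonal complement of some unit
vector `g` exceeds the energy of `g` by `δ`. -/
lemma le_spectralGap {H : Matrix ι ι ℂ} (hH : H.IsHermitian) (hc : 2 ≤ Fintype.card ι) {δ e : ℝ}
    (g : EuclideanSpace ℂ ι) (hg : ‖g‖ = 1) (he : energy H g ≤ e)
    (h : ∀ x, inner ℂ g x = 0 → (e + δ) * ‖x‖ ^ 2 ≤ energy H x) : δ ≤ spectralGap H := by
  obtain ⟨i₁, i₂, hne, hgap, h1, h2⟩ := spectralGap_eq_sub hH hc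
  set b := hH.eigenvectorBasis with hb
  have hlow : hH.eigenvalues i₁ ≤ e := by
    refine le_trans ?_ he
    rw [energy_eq_sum_eigenvalues hH]
    calc hH.eigenvalues i₁ = hH.eigenvalues i₁ * ∑ j, ‖inner ℂ (b j) g‖ ^ 2 := by
          rw [b.sum_sq_norm_inner_right, hg]; simp
      _ ≤ _ := by
          rw [Finset.mul_sum]
          exact Finset.sum_le_sum fun j _ => mul_le_mul_of_nonneg_right (h1 j) (sq_nonneg _)
  -- Courant–Fischer: the span of the two lowest eigenvectors has dimension two, so it contains a
  -- nonzero vector orthogonal to `g`, and the energy there is at most the second eigenvalue.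
  obtain ⟨α, β, hαβ, hne0⟩ : ∃ α β : ℂ, α * inner ℂ g (b i₁) + β * inner ℂ g (b i₂) = 0 ∧
      0 < ‖α‖ ^ 2 + ‖β‖ ^ 2 := by
    by_cases h0 : inner ℂ g (b i₁) = 0
    · exact ⟨1, 0, by simp [h0], by simp⟩
    · refine ⟨-inner ℂ g (b i₂), inner ℂ g (b i₁), by ring, ?_⟩
      have := norm_pos_iff.mpr h0
      positivity
  set x := α • b i₁ + β • b i₂ with hx
  have hin : ∀ j, inner ℂ (b j) x = (if j = i₁ then α else 0) + (if j = i₂ then β else 0) := by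
    intro j
    rw [hx, inner_add_right, inner_smul_right, inner_smul_right,
      orthonormal_iff_ite.mp b.orthonormal, orthonormal_iff_ite.mp b.orthonormal]
    simp
  have hsum : ∀ f : ι → ℝ, ∑ j, f j * ‖inner ℂ (b j) x‖ ^ 2
      = f i₁ * ‖α‖ ^ 2 + f i₂ * ‖β‖ ^ 2 := by
    intro f
    rw [Finset.sum_eq_add i₁ i₂ hne]
    · rw [hin, hin]; simp [hne, hne.symm]
    · intro j _ hj; rw [hin]; simp [hj.1, hj.2]
    · simp
    · simp
  have hnx : ‖x‖ ^ 2 = ‖α‖ ^ 2 + ‖β‖ ^ 2 := by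
    rw [← b.sum_sq_norm_inner_right x]
    simpa using hsum fun _ => 1
  have hxE := h x (by rw [hx, inner_add_right, inner_smul_right, inner_smul_right, hαβ])
  rw [energy_eq_sum_eigenvalues hH, hsum, hnx] at hxE
  have h3 := h1 i₂
  have : (e + δ) * (‖α‖ ^ 2 + ‖β‖ ^ 2) ≤ hH.eigenvalues i₂ * (‖α‖ ^ 2 + ‖β‖ ^ 2) := by
    nlinarith [sq_nonneg ‖α‖]
  have := le_of_mul_le_mul_right this hne0
  rw [hgap]; linarith

/-- Expanding in eigenvectors turns a gap into a quadratic form inequality. In this form it can be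
applied slice by slice in a tensor product and survives small perturbations. -/
lemma exists_ground {H : Matrix ι ι ℂ} (hH : H.IsHermitian) (hc : 2 ≤ Fintype.card ι) {δ : ℝ}
    (hδ : δ ≤ spectralGap H) :
    ∃ g : EuclideanSpace ℂ ι, ‖g‖ = 1 ∧ ∀ x, energy H g * ‖x‖ ^ 2
      + δ * (‖x‖ ^ 2 - ‖inner ℂ g x‖ ^ 2) ≤ energy H x := by
  obtain ⟨i₁, i₂, hne, hgap, h1, h2⟩ := spectralGap_eq_sub hH hc
  set b := hH.eigenvectorBasis with hb
  refine ⟨b i₁, b.orthonormal.norm_eq_one _, fun x => ?_⟩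
  have hE : energy H (b i₁) = hH.eigenvalues i₁ := by
    rw [energy, toEuclideanCLM_eigenvectorBasis, inner_smul_right, inner_self_eq_norm_sq_to_K,
      b.orthonormal.norm_eq_one]
    simp
  rw [hE, energy_eq_sum_eigenvalues hH, ← b.sum_sq_norm_inner_right x,
    ← Finset.add_sum_erase _ _ (Finset.mem_univ i₁), ← Finset.add_sum_erase _ _ (Finset.mem_univ i₁),
    add_sub_cancel_left, mul_add, add_assoc, ← add_mul, Finset.mul_sum]
  gcongr with j hj
  have := h2 j (Finset.ne_of_mem_erase hj)
  linarith

/-- Gap of a perturbed matrix from the gap on one block and a large energy on the other. -/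
lemma half_le_spectralGap_of_split {A B : Matrix ι ι ℂ} (hA : A.IsHermitian) (hB : B.IsHermitian)
    (hc : 2 ≤ Fintype.card ι) {δ e M R : ℝ} (hδ : 0 < δ) (hR : opNorm B ≤ R)
    (hM : R ^ 2 ≤ (M - R - δ / 2) * (δ / 2))
    (g : EuclideanSpace ℂ ι) (hg : ‖g‖ = 1) (he : energy A g + energy B g ≤ e)
    (h : ∀ x, inner ℂ g x = 0 → ∃ y z, x = y + z ∧ ‖x‖ ^ 2 = ‖y‖ ^ 2 + ‖z‖ ^ 2 ∧
      (e + δ) * ‖y‖ ^ 2 + (e + M) * ‖z‖ ^ 2 ≤ energy A x + energy B y) :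
    δ / 2 ≤ spectralGap (A + B) := by
  refine le_spectralGap (e := e) (hA.add hB) hc g hg (by rwa [energy_add]) fun x hx => ?_
  obtain ⟨y, z, rfl, hn, hE⟩ := h x hx
  have h1 := energy_add_vec_ge B y z
  rw [energy_add, hn]
  have hyz : 0 ≤ ‖y‖ * ‖z‖ := by positivity
  have hR1 : opNorm B * (‖y‖ * ‖z‖) ≤ R * (‖y‖ * ‖z‖) := by gcongr
  have hR2 : opNorm B * ‖z‖ ^ 2 ≤ R * ‖z‖ ^ 2 := by gcongr
  -- The cross term of `B` is absorbed by half of the gap on `y` and by the surplus energy on `z`;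
  -- `R` is set aside for the energy of `B` at `z`, and `δ / 2` for the claimed gap. `hM` is the
  -- discriminant condition of this quadratic form.
  have key : 2 * R * (‖y‖ * ‖z‖) ≤ δ / 2 * ‖y‖ ^ 2 + (M - R - δ / 2) * ‖z‖ ^ 2 := by
    have h3 : 0 ≤ (δ / 2 * ‖y‖ - R * ‖z‖) ^ 2 := sq_nonneg _
    have h4 : R ^ 2 * ‖z‖ ^ 2 ≤ (M - R - δ / 2) * (δ / 2) * ‖z‖ ^ 2 := by gcongr
    have : δ / 2 * (2 * R * (‖y‖ * ‖z‖))
        ≤ δ / 2 * (δ / 2 * ‖y‖ ^ 2 + (M - R - δ / 2) * ‖z‖ ^ 2) := by nlinarith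
    exact le_of_mul_le_mul_left this (by positivity)
  nlinarith

/-! ### Hermitian and diagonal matrices -/

section Hermitian

variable {ι : Type}

lemma isHermitian_real_smul {A : Matrix ι ι ℂ} (hA : A.IsHermitian) (r : ℝ) :
    (r • A).IsHermitian := by
  rw [Matrix.IsHermitian, Matrix.conjTranspose_smul, hA.eq]; simp

lemma isHermitian_diagonal_ofReal [DecidableEq ι] (d : ι → ℝ) :
    (Matrix.diagonal fun i => (d i : ℂ)).IsHermitian :=
  Matrix.isHermitian_diagonal_of_self_adjoint _ (by ext; simp)

lemma isHermitian_sum {κ : Type} (s : Finset κ) {A : κ → Matrix ι ι ℂ}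
    (h : ∀ k, (A k).IsHermitian) : (∑ k ∈ s, A k).IsHermitian := by
  rw [Matrix.IsHermitian, Matrix.conjTranspose_sum]
  exact Finset.sum_congr rfl fun k _ => (h k).eq

lemma isHermitian_kronecker {κ : Type} {A : Matrix ι ι ℂ} {B : Matrix κ κ ℂ}
    (hA : A.IsHermitian) (hB : B.IsHermitian) : (A ⊗ₖ B).IsHermitian := by
  rw [Matrix.IsHermitian, Matrix.conjTranspose_kronecker, hA.eq, hB.eq]

lemma update_not_eq_comm {V : Type} [DecidableEq V] (u : V) (x y : Bits V) :
    y = Function.update x u (!(x u)) ↔ x = Function.update y u (!(y u)) := by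
  constructor <;> (rintro rfl; simp)

end Hermitian

section Diagonal

variable {ι : Type} [Fintype ι] [DecidableEq ι]

lemma energy_diagonal (d : ι → ℝ) (x : EuclideanSpace ℂ ι) :
    energy (Matrix.diagonal fun i => (d i : ℂ)) x = ∑ i, d i * ‖x i‖ ^ 2 := by
  simp only [energy, PiLp.inner_apply, Matrix.ofLp_toEuclideanCLM, Matrix.mulVec_diagonal]
  rw [Complex.re_sum]
  refine Finset.sum_congr rfl fun i _ => ?_
  simp only [RCLike.inner_apply]
  rw [mul_assoc, Complex.mul_conj, Complex.normSq_eq_norm_sq]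
  norm_cast

lemma opNorm_diagonal_le (d : ι → ℂ) {r : ℝ} (hr : 0 ≤ r) (h : ∀ i, ‖d i‖ ≤ r) :
    opNorm (Matrix.diagonal d) ≤ r := by
  have := Matrix.l2_opNorm_diagonal (𝕜 := ℂ) d
  rw [Matrix.cstar_norm_def] at this
  rw [opNorm, this]
  exact (pi_norm_le_iff_of_nonneg hr).mpr h

open scoped Matrix.Norms.L2Operator in
lemma opNorm_le_one_of_conjTranspose_mul_self {U : Matrix ι ι ℂ} (hU : U.conjTranspose * U = 1) :
    opNorm U ≤ 1 := by
  have h1 := Matrix.l2_opNorm_conjTranspose_mul_self U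
  rw [hU] at h1
  have h2 : ‖(1 : Matrix ι ι ℂ)‖ ≤ 1 := by
    rw [← Matrix.diagonal_one, Matrix.l2_opNorm_diagonal]
    exact (pi_norm_le_iff_of_nonneg zero_le_one).mpr fun i => by simp
  change ‖U‖ ≤ 1
  nlinarith [norm_nonneg U]

lemma energy_single (A : Matrix ι ι ℂ) (i : ι) :
    energy A (EuclideanSpace.single i 1) = (A i i).re := by
  simp [energy, EuclideanSpace.inner_single_left, Matrix.ofLp_toEuclideanCLM]

lemma norm_apply_le_opNorm (A : Matrix ι ι ℂ) (i : ι) : ‖A i i‖ ≤ opNorm A := by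
  have := norm_inner_le_opNorm A (EuclideanSpace.single i 1) (EuclideanSpace.single i 1)
  simpa [EuclideanSpace.inner_single_left, Matrix.ofLp_toEuclideanCLM] using this

end Diagonal

/-! ### Pauli operators and the transverse fields -/

section Pauli

variable {V : Type} [Fintype V] [DecidableEq V]

lemma pauliX_isHermitian (u : V) : (pauliX u : Op V).IsHermitian := by
  ext x y
  simp only [pauliX, Matrix.conjTranspose_apply, Matrix.of_apply]
  simp only [update_not_eq_comm u y x]
  split_ifs <;> simp

lemma pauliX_mul_self (u : V) : (pauliX u * pauliX u : Op V) = 1 := by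
  ext x y
  simp only [pauliX, Matrix.mul_apply, Matrix.of_apply, ite_mul, one_mul, zero_mul,
    Finset.sum_ite_eq', Finset.mem_univ, if_true, Matrix.one_apply]
  simp [eq_comm]

lemma pauliX_apply_self (u : V) (x : Bits V) : (pauliX u : Op V) x x = 0 := by
  simp only [pauliX, Matrix.of_apply, ite_eq_right_iff, one_ne_zero, imp_false]
  intro h
  have := congrFun h u
  simp at this

lemma opNorm_pauliX_le (u : V) : opNorm (pauliX u : Op V) ≤ 1 :=
  opNorm_le_one_of_conjTranspose_mul_self (by rw [(pauliX_isHermitian u).eq, pauliX_mul_self])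

lemma opNorm_pauliX_kronecker_one_le {W : Type} [Fintype W] [DecidableEq W] (u : V) :
    opNorm ((pauliX u : Op V) ⊗ₖ (1 : Op W)) ≤ 1 := by
  apply opNorm_le_one_of_conjTranspose_mul_self
  rw [Matrix.conjTranspose_kronecker, ← Matrix.mul_kronecker_mul, (pauliX_isHermitian u).eq,
    pauliX_mul_self]
  simp

lemma opNorm_one_kronecker_pauliX_le {W : Type} [Fintype W] [DecidableEq W] (u : V) :
    opNorm ((1 : Op W) ⊗ₖ (pauliX u : Op V)) ≤ 1 := by
  apply opNorm_le_one_of_conjTranspose_mul_self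
  rw [Matrix.conjTranspose_kronecker, ← Matrix.mul_kronecker_mul, (pauliX_isHermitian u).eq,
    pauliX_mul_self]
  simp

/-- The eigenvalue of the Pauli operator `Z` on a bit. -/
def zSign (b : Bool) : ℝ := if b then -1 else 1

lemma pauliZ_eq (u : V) : pauliZ u = Matrix.diagonal fun x : Bits V => ((zSign (x u) : ℝ) : ℂ) := by
  unfold pauliZ zSign
  congr 1; ext x; split_ifs <;> simp

end Pauli

section Field

lemma XB_isHermitian (nB : ℕ) (ΔB : ℝ) : (XB nB ΔB).IsHermitian :=
  (isHermitian_real_smul (isHermitian_sum _ fun i => pauliX_isHermitian i) _).neg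

lemma XL_isHermitian (ℓ : ℕ) : (XL ℓ).IsHermitian :=
  (isHermitian_sum _ fun i => pauliX_isHermitian i).neg

lemma XB_apply_self (nB : ℕ) (ΔB : ℝ) (x : Bits (Fin nB)) : XB nB ΔB x x = 0 := by
  simp [XB, Matrix.sum_apply, pauliX_apply_self]

lemma XL_apply_self (ℓ : ℕ) (x : Bits (Fin ℓ)) : XL ℓ x x = 0 := by
  simp [XL, Matrix.sum_apply, pauliX_apply_self]

lemma opNorm_XB_le (nB : ℕ) {ΔB : ℝ} (h : 0 ≤ ΔB) : opNorm (XB nB ΔB) ≤ ΔB * nB := by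
  rw [XB, opNorm_neg, opNorm_smul, abs_of_nonneg h]
  gcongr
  refine (opNorm_sum_le _ _).trans ((Finset.sum_le_sum fun i _ => opNorm_pauliX_le i).trans ?_)
  simp

lemma opNorm_XL_le (ℓ : ℕ) : opNorm (XL ℓ) ≤ ℓ := by
  rw [XL, opNorm_neg]
  refine (opNorm_sum_le _ _).trans ((Finset.sum_le_sum fun i _ => opNorm_pauliX_le i).trans ?_)
  simp

lemma sum_kronecker {κ V W : Type} (s : Finset κ) (A : κ → Matrix V V ℂ) (B : Matrix W W ℂ) :
    (∑ k ∈ s, A k) ⊗ₖ B = ∑ k ∈ s, A k ⊗ₖ B := by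
  ext i j
  simp [Matrix.sum_apply, Finset.sum_mul]

lemma kronecker_sum {κ V W : Type} (s : Finset κ) (A : κ → Matrix V V ℂ) (B : Matrix W W ℂ) :
    B ⊗ₖ (∑ k ∈ s, A k) = ∑ k ∈ s, B ⊗ₖ A k := by
  ext i j
  simp [Matrix.sum_apply, Finset.mul_sum]

lemma neg_kronecker {V W : Type} (A : Matrix V V ℂ) (B : Matrix W W ℂ) :
    (-A) ⊗ₖ B = -(A ⊗ₖ B) := by
  ext i j
  simp

lemma kronecker_neg {V W : Type} (A : Matrix V V ℂ) (B : Matrix W W ℂ) :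
    A ⊗ₖ (-B) = -(A ⊗ₖ B) := by
  ext i j
  simp

lemma XB_kronecker_one (nB ℓ : ℕ) (ΔB : ℝ) : XB nB ΔB ⊗ₖ (1 : Op (Fin ℓ))
    = -(ΔB • ∑ i : Fin nB, pauliX i ⊗ₖ (1 : Op (Fin ℓ))) := by
  rw [XB, neg_kronecker, Matrix.smul_kronecker, sum_kronecker]

lemma one_kronecker_XL (nB ℓ : ℕ) : (1 : Op (Fin nB)) ⊗ₖ XL ℓ
    = -∑ i : Fin ℓ, (1 : Op (Fin nB)) ⊗ₖ pauliX i := by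
  rw [XL, kronecker_neg, kronecker_sum]

lemma opNorm_XB_kronecker_one_le (nB ℓ : ℕ) {ΔB : ℝ} (h : 0 ≤ ΔB) :
    opNorm (XB nB ΔB ⊗ₖ (1 : Op (Fin ℓ))) ≤ ΔB * nB := by
  rw [XB_kronecker_one, opNorm_neg, opNorm_smul, abs_of_nonneg h]
  gcongr
  refine (opNorm_sum_le _ _).trans
    ((Finset.sum_le_sum fun i _ => opNorm_pauliX_kronecker_one_le i).trans ?_)
  simp

lemma opNorm_one_kronecker_XL_le (nB ℓ : ℕ) : opNorm ((1 : Op (Fin nB)) ⊗ₖ XL ℓ) ≤ ℓ := by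
  rw [one_kronecker_XL, opNorm_neg]
  refine (opNorm_sum_le _ _).trans
    ((Finset.sum_le_sum fun i _ => opNorm_one_kronecker_pauliX_le i).trans ?_)
  simp

end Field

/-! ### The diagonal part of the clock Hamiltonian -/

section ClockStates

variable (ℓ : ℕ)

/-- The diagonal of `ε_L Z_L(t)`. -/
def tiltPotential (t : ℝ) (z : Bits (Fin ℓ)) : ℝ :=
  ∑ i : Fin ℓ, (((i : ℕ) : ℝ) + 1 - t) * (1 - zSign (z i))

lemma ZL_eq (εL t : ℝ) : ZL ℓ εL t
    = Matrix.diagonal fun z => ((tiltPotential ℓ t z / εL : ℝ) : ℂ) := by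
  ext x y
  simp only [ZL, pauliZ_eq, tiltPotential, Matrix.smul_apply,
    Matrix.sub_apply, Matrix.sum_apply]
  by_cases h : x = y
  · subst h
    simp [div_eq_inv_mul]
  · simp [h]

/-- A string in which no 0 is followed by a 1 stays 0 after its first 0. Padding it with zeros
beyond `ℓ` makes a first 0 exist also for the all-ones string. -/
lemma exists_eq_clock {z : Bits (Fin ℓ)} (h : ∀ i : Fin (ℓ - 1),
    ¬ (z ⟨(i : ℕ), by omega⟩ = false ∧ z ⟨(i : ℕ) + 1, by omega⟩ = true)) :
    ∃ j, z = clock ℓ j := by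
  set f : ℕ → Bool := fun i => if h : i < ℓ then z ⟨i, h⟩ else false with hf
  have hstep : ∀ i, f i = false → f (i + 1) = false := by
    intro i hi
    by_cases h1 : i + 1 < ℓ
    · have h0 : i < ℓ := by omega
      have := h ⟨i, by omega⟩
      simp only [hf, h1, h0, dif_pos] at hi ⊢
      simpa [hi] using this
    · simp [hf, h1]
  have hex : ∃ i, f i = false := ⟨ℓ, by simp [hf]⟩
  classical
  refine ⟨⟨Nat.find hex, Nat.lt_succ_of_le (Nat.find_min' hex (by simp [hf]))⟩, ?_⟩
  ext i
  have hi : z i = f i := by simp [hf]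
  rw [hi]
  by_cases hlt : (i : ℕ) < Nat.find hex
  · have := Nat.find_min hex hlt
    simp only [clock, hlt, decide_true]
    simpa using this
  · simp only [clock, hlt, decide_false]
    exact Nat.le_induction (m := Nat.find hex) (Nat.find_spec hex) (fun k _ hk => hstep k hk) i
      (not_lt.mp hlt)

/-- Only the first `j` bits contribute, bit number `i` giving `2 (i - t)`. The result is a parabola
in `j` centred at `t - 1/2`, so consecutive levels cross one after another as `t` grows. -/
lemma tiltPotential_clock (t : ℝ) (j : Fin (ℓ + 1)) :
    tiltPotential ℓ t (clock ℓ j) = (j : ℕ) * ((j : ℕ) + 1 - 2 * t) := by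
  unfold tiltPotential
  have h1 : ∀ i : Fin ℓ, (((i : ℕ) : ℝ) + 1 - t) * (1 - zSign (clock ℓ j i))
      = (fun i : ℕ => if i < (j : ℕ) then 2 * ((i : ℝ) + 1 - t) else 0) i := by
    intro i
    simp only [clock, zSign, decide_eq_true_eq]
    split_ifs <;> ring
  rw [Finset.sum_congr rfl fun i _ => h1 i, Fin.sum_univ_eq_sum_range
    (fun i : ℕ => if i < (j : ℕ) then 2 * ((i : ℝ) + 1 - t) else 0), ← Finset.sum_filter]
  have h2 : (Finset.range ℓ).filter (fun i => i < (j : ℕ)) = Finset.range j := by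
    ext i; simp; have := j.2; omega
  rw [h2]
  generalize (j : ℕ) = k
  induction k with
  | zero => simp
  | succ k ih => rw [Finset.sum_range_succ, ih]; push_cast; ring

lemma abs_tiltPotential_le {t T : ℝ} (ht : |t| ≤ T) (z : Bits (Fin ℓ)) :
    |tiltPotential ℓ t z| ≤ 2 * ℓ * (ℓ + T) := by
  unfold tiltPotential
  refine (Finset.abs_sum_le_sum_abs _ _).trans ?_
  refine (Finset.sum_le_card_nsmul _ _ (2 * (ℓ + T)) fun i _ => ?_).trans ?_
  · rw [abs_mul]
    have h1 : |1 - zSign (z i)| ≤ 2 := by unfold zSign; split_ifs <;> norm_num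
    have h2 : |((i : ℕ) : ℝ) + 1 - t| ≤ ℓ + T := by
      have h3 : ((i : ℕ) : ℝ) + 1 ≤ ℓ := by exact_mod_cast i.2
      have h4 : (0 : ℝ) ≤ ((i : ℕ) : ℝ) := by positivity
      rw [abs_le] at ht ⊢
      constructor <;> linarith [ht.1, ht.2]
    nlinarith [abs_nonneg (1 - zSign (z i)), abs_nonneg (((i : ℕ) : ℝ) + 1 - t)]
  · simp only [Finset.card_univ, Fintype.card_fin, nsmul_eq_mul]
    exact le_of_eq (by ring)

lemma clock_injective : Function.Injective (clock ℓ) := by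
  intro i j h
  by_contra hne
  wlog hlt : i < j generalizing i j
  · exact this h.symm (Ne.symm hne) (lt_of_le_of_ne (not_lt.mp hlt) (Ne.symm hne))
  have := congrFun h ⟨i, by have := j.2; omega⟩
  simp [clock] at this
  omega

end ClockStates

section ClockPotential

variable (ℓ : ℕ) [NeZero ℓ]

/-- The diagonal of `Q_L / Δ_L`. -/
def wallPotential (z : Bits (Fin ℓ)) : ℝ :=
  (ℓ : ℝ) - 1 + zSign (z 0) - zSign (z (Fin.rev 0))
    - ∑ i : Fin (ℓ - 1), zSign (z ⟨(i : ℕ), by omega⟩) * zSign (z ⟨(i : ℕ) + 1, by omega⟩)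

/-- The diagonal of the clock Hamiltonian. -/
def clockPotential (ΔL εL t : ℝ) (z : Bits (Fin ℓ)) : ℝ :=
  ΔL * wallPotential ℓ z + tiltPotential ℓ t z / εL

lemma QL_eq (ΔL : ℝ) : QL ℓ ΔL
    = Matrix.diagonal fun z => ((ΔL * wallPotential ℓ z : ℝ) : ℂ) := by
  ext x y
  simp only [QL, pauliZ_eq, Matrix.diagonal_mul_diagonal, wallPotential, Matrix.smul_apply,
    Matrix.sub_apply, Matrix.add_apply, Matrix.sum_apply]
  by_cases h : x = y
  · subst h
    simp
  · simp [h]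

lemma QL_add_ZL (ΔL εL t : ℝ) : QL ℓ ΔL + ZL ℓ εL t
    = Matrix.diagonal fun z => ((clockPotential ℓ ΔL εL t z : ℝ) : ℂ) := by
  rw [QL_eq, ZL_eq, Matrix.diagonal_add]
  congr 1; ext z; simp [clockPotential]

/-- The boundary fields telescope into the differences of neighbouring signs. These cancel the Ising
penalty of a wall 10 and double that of a wall 01, so exactly the clock states have energy zero. -/
lemma wallPotential_eq (z : Bits (Fin ℓ)) : wallPotential ℓ z
    = ∑ i : Fin (ℓ - 1), if z ⟨(i : ℕ), by omega⟩ = false ∧ z ⟨(i : ℕ) + 1, by omega⟩ = true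
        then (4 : ℝ) else 0 := by
  obtain ⟨n, rfl⟩ : ∃ n, ℓ = n + 1 := ⟨ℓ - 1, by have := NeZero.ne ℓ; omega⟩
  unfold wallPotential
  have hterm : ∀ i : Fin n, (if z ⟨(i : ℕ), by omega⟩ = false ∧ z ⟨(i : ℕ) + 1, by omega⟩ = true
      then (4 : ℝ) else 0) = 1 - zSign (z ⟨(i : ℕ), by omega⟩) * zSign (z ⟨(i : ℕ) + 1, by omega⟩)
        - (zSign (z ⟨(i : ℕ) + 1, by omega⟩) - zSign (z ⟨(i : ℕ), by omega⟩)) := by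
    intro i
    cases z ⟨(i : ℕ), by omega⟩ <;> cases z ⟨(i : ℕ) + 1, by omega⟩ <;> norm_num [zSign]
  have htel : ∑ i : Fin n, (zSign (z ⟨(i : ℕ) + 1, by omega⟩) - zSign (z ⟨(i : ℕ), by omega⟩))
      = zSign (z (Fin.rev 0)) - zSign (z 0) := by
    have h := Finset.sum_range_sub (fun i : ℕ => if h : i < n + 1 then zSign (z ⟨i, h⟩) else 0) n
    rw [← Fin.sum_univ_eq_sum_range (fun i => (fun i : ℕ => if h : i < n + 1 then
      zSign (z ⟨i, h⟩) else 0) (i + 1) - (fun i : ℕ => if h : i < n + 1 then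
      zSign (z ⟨i, h⟩) else 0) i)] at h
    simp only [lt_add_iff_pos_left, Nat.add_lt_add_iff_right, Fin.is_lt, dif_pos, Nat.lt_succ_self,
      Nat.succ_pos] at h
    have h' : ∀ i : Fin n, (i : ℕ) < n + 1 := fun i => by omega
    simp only [h', dif_pos] at h
    rw [h]
    simp [Fin.rev]
  refine Eq.symm ((Finset.sum_congr rfl fun i _ => hterm i).trans ?_)
  rw [Finset.sum_sub_distrib, Finset.sum_sub_distrib, htel]
  simp
  ring

lemma wallPotential_nonneg (z : Bits (Fin ℓ)) : 0 ≤ wallPotential ℓ z := by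
  rw [wallPotential_eq]
  exact Finset.sum_nonneg fun i _ => by split_ifs <;> norm_num

lemma wallPotential_clock (j : Fin (ℓ + 1)) : wallPotential ℓ (clock ℓ j) = 0 := by
  rw [wallPotential_eq]
  refine Finset.sum_eq_zero fun i _ => if_neg ?_
  simp only [clock, decide_eq_false_iff_not, decide_eq_true_eq]
  omega

lemma four_le_wallPotential {z : Bits (Fin ℓ)} (hz : ∀ j, z ≠ clock ℓ j) :
    4 ≤ wallPotential ℓ z := by
  have : ∃ i : Fin (ℓ - 1), (z ⟨(i : ℕ), by omega⟩ = false ∧ z ⟨(i : ℕ) + 1, by omega⟩ = true) := by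
    by_contra hcon
    push Not at hcon
    obtain ⟨j, hj⟩ := exists_eq_clock ℓ (z := z) (fun i hi => hcon i hi.1 hi.2)
    exact hz j hj
  obtain ⟨i, hi⟩ := this
  rw [wallPotential_eq]
  refine le_trans ?_ (Finset.single_le_sum (f := fun i : Fin (ℓ - 1) =>
    if z ⟨(i : ℕ), by omega⟩ = false ∧ z ⟨(i : ℕ) + 1, by omega⟩ = true
        then (4 : ℝ) else 0) (fun i _ => by split_ifs <;> norm_num) (Finset.mem_univ i))
  simp [hi]

lemma wallPotential_le (z : Bits (Fin ℓ)) : wallPotential ℓ z ≤ 4 * ℓ := by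
  rw [wallPotential_eq]
  refine (Finset.sum_le_card_nsmul _ _ 4 fun i _ => by split_ifs <;> norm_num).trans ?_
  simp only [Finset.card_univ, Fintype.card_fin, nsmul_eq_mul]
  have : ((ℓ - 1 : ℕ) : ℝ) ≤ ℓ := by exact_mod_cast Nat.sub_le _ _
  linarith

lemma clockPotential_clock (ΔL εL t : ℝ) (j : Fin (ℓ + 1)) :
    clockPotential ℓ ΔL εL t (clock ℓ j) = (j : ℕ) * ((j : ℕ) + 1 - 2 * t) / εL := by
  rw [clockPotential, wallPotential_clock, tiltPotential_clock]; ring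

end ClockPotential

/-! ### Gap and ground state of the clock -/

section ClockGround

variable {ℓ : ℕ}

lemma two_le_card_bits (ℓ : ℕ) [NeZero ℓ] : 2 ≤ Fintype.card (Bits (Fin ℓ)) := by
  simp only [Fintype.card_fun, Fintype.card_bool, Fintype.card_fin]
  exact Nat.le_self_pow (NeZero.ne ℓ) 2

lemma abs_energy_smul_XL_le {f : ℝ} (hf0 : 0 ≤ f) (hf2 : f ≤ 2)
    (x : EuclideanSpace ℂ (Bits (Fin ℓ))) : |energy (f • XL ℓ) x| ≤ 2 * ℓ * ‖x‖ ^ 2 := by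
  refine (abs_energy_le _ _).trans ?_
  gcongr
  rw [opNorm_smul, abs_of_nonneg hf0]
  exact mul_le_mul hf2 (opNorm_XL_le ℓ) (opNorm_nonneg _) (by norm_num)

/-- The basis state at `z₀` serves as trial vector: the field has no diagonal entries, so it leaves
this energy unchanged, and it lowers energies on the complement by at most `2ℓ`. -/
lemma half_le_spectralGap_of_isolated [NeZero ℓ] (E : Bits (Fin ℓ) → ℝ) {f μ : ℝ} (hf0 : 0 ≤ f)
    (hf2 : f ≤ 2) (hμ : 2 * ℓ + 1 / 2 ≤ μ) (z₀ : Bits (Fin ℓ))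
    (hE : ∀ z, z ≠ z₀ → E z₀ + μ ≤ E z) :
    1 / 2 ≤ spectralGap ((Matrix.diagonal fun z => (E z : ℂ)) + f • XL ℓ) := by
  refine le_spectralGap (e := E z₀) ((isHermitian_diagonal_ofReal E).add
    (isHermitian_real_smul (XL_isHermitian ℓ) f)) (two_le_card_bits ℓ)
    (EuclideanSpace.single z₀ 1) (by simp) ?_ fun x hx => ?_
  · rw [energy_single]
    simp [XL_apply_self]
  · have hx0 : x z₀ = 0 := by simpa [EuclideanSpace.inner_single_left] using hx
    rw [energy_add, energy_diagonal]
    have h1 : (E z₀ + μ) * ‖x‖ ^ 2 ≤ ∑ z, E z * ‖x z‖ ^ 2 := by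
      rw [EuclideanSpace.norm_sq_eq, Finset.mul_sum]
      refine Finset.sum_le_sum fun z _ => ?_
      by_cases hz : z = z₀
      · simp [hz, hx0]
      · exact mul_le_mul_of_nonneg_right (hE z hz) (sq_nonneg _)
    have h2 := (abs_le.mp (abs_energy_smul_XL_le hf0 hf2 x)).1
    nlinarith [sq_nonneg ‖x‖]

lemma energy_single_add_single {ι : Type} [Fintype ι] [DecidableEq ι] (A : Matrix ι ι ℂ) {i j : ι}
    {r : ℝ} (hi : A i i = 0) (hj : A j j = 0) (hij : A i j = r) (hji : A j i = r) (a b : ℂ) :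
    energy A (EuclideanSpace.single i a + EuclideanSpace.single j b)
      = 2 * r * (starRingEnd ℂ a * b).re := by
  simp only [energy, inner_add_left, EuclideanSpace.inner_single_left, Matrix.ofLp_toEuclideanCLM,
    WithLp.ofLp_add, Matrix.mulVec_add, Pi.add_apply, PiLp.ofLp_single, Matrix.mulVec_single]
  simp [hi, hj, hij, hji]
  ring

/-- The trial vector is the symmetric combination of the two states; inside the pair its complement
is the antisymmetric one. Both have diagonal energy `(E z₁ + E z₂) / 2`, and the field separates
them by `2 * f`. Thus the detuning `E z₁ - E z₂` drops out, and one bound serves through the whole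
level crossing. -/
lemma half_le_spectralGap_of_isolated_pair [NeZero ℓ] (E : Bits (Fin ℓ) → ℝ) {f μ : ℝ}
    (hf0 : 1 / 2 ≤ f) (hf2 : f ≤ 2) (hμ : 10 * (ℓ : ℝ) ^ 2 ≤ μ) {z₁ z₂ : Bits (Fin ℓ)}
    (hne : z₁ ≠ z₂) (h12 : XL ℓ z₁ z₂ = -1) (h21 : XL ℓ z₂ z₁ = -1)
    (hE : ∀ z, z ≠ z₁ → z ≠ z₂ → (E z₁ + E z₂) / 2 + μ ≤ E z) :
    1 / 2 ≤ spectralGap ((Matrix.diagonal fun z => (E z : ℂ)) + f • XL ℓ) := by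
  have hℓ : (1 : ℝ) ≤ ℓ := by exact_mod_cast Nat.one_le_iff_ne_zero.mpr (NeZero.ne ℓ)
  set A : Op (Fin ℓ) := Matrix.diagonal fun z => (E z : ℂ) with hA
  set B : Op (Fin ℓ) := f • XL ℓ with hB
  have hB1 : B z₁ z₁ = 0 := by simp [hB, XL_apply_self]
  have hB2 : B z₂ z₂ = 0 := by simp [hB, XL_apply_self]
  have hB12 : B z₁ z₂ = (-f : ℝ) := by simp [hB, h12]
  have hB21 : B z₂ z₁ = (-f : ℝ) := by simp [hB, h21]
  have hnorm : opNorm B ≤ 2 * ℓ := by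
    rw [hB, opNorm_smul, abs_of_nonneg (by linarith)]
    exact mul_le_mul hf2 (opNorm_XL_le ℓ) (opNorm_nonneg _) (by norm_num)
  set s : ℂ := ((1 / √2 : ℝ) : ℂ) with hs
  have hss : (1 / √2 : ℝ) ^ 2 = 1 / 2 := by
    rw [div_pow, Real.sq_sqrt (by norm_num)]; norm_num
  have hsn : ‖s‖ ^ 2 = 1 / 2 := by
    rw [hs, Complex.norm_real, Real.norm_eq_abs, sq_abs, hss]
  have happ : ∀ (a b : ℂ) z, (EuclideanSpace.single z₁ a + EuclideanSpace.single z₂ b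
      : EuclideanSpace ℂ (Bits (Fin ℓ))) z = if z = z₁ then a else if z = z₂ then b else 0 := by
    intro a b z
    by_cases h1 : z = z₁
    · subst h1; simp [hne]
    · simp [h1]
  have hsum : ∀ (a b : ℂ) (d : Bits (Fin ℓ) → ℝ), ∑ z, d z * ‖(EuclideanSpace.single z₁ a +
      EuclideanSpace.single z₂ b : EuclideanSpace ℂ (Bits (Fin ℓ))) z‖ ^ 2
      = d z₁ * ‖a‖ ^ 2 + d z₂ * ‖b‖ ^ 2 := by
    intro a b d
    rw [Finset.sum_eq_add z₁ z₂ hne]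
    · simp only [happ]; simp [hne.symm]
    · intro z _ hz; simp only [happ]; simp [hz.1, hz.2]
    · simp
    · simp
  have hM : (2 * (ℓ : ℝ)) ^ 2 ≤ (μ + f - 2 * ℓ - 2 * f / 2) * (2 * f / 2) := by
    have h1 : 8 * (ℓ : ℝ) ^ 2 ≤ μ - 2 * ℓ := by nlinarith
    nlinarith [sq_nonneg (ℓ : ℝ)]
  refine le_trans ?_ (half_le_spectralGap_of_split (A := A) (B := B) (δ := 2 * f) (e := (E z₁ + E z₂) / 2 - f)
    (M := μ + f) (R := 2 * ℓ)
    (isHermitian_diagonal_ofReal E) (isHermitian_real_smul (XL_isHermitian ℓ) f)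
    (two_le_card_bits ℓ) (by linarith) hnorm hM
    (EuclideanSpace.single z₁ s + EuclideanSpace.single z₂ s) ?_ ?_ fun x hx => ?_)
  · linarith
  · have := hsum s s fun _ => 1
    simp only [one_mul] at this
    rw [← EuclideanSpace.norm_sq_eq, hsn] at this
    nlinarith [norm_nonneg (EuclideanSpace.single z₁ s + EuclideanSpace.single z₂ s
      : EuclideanSpace ℂ (Bits (Fin ℓ)))]
  · rw [hA, energy_diagonal, hsum, energy_single_add_single B hB1 hB2 hB12 hB21, hsn,
      ← Complex.normSq_eq_conj_mul_self, Complex.ofReal_re, Complex.normSq_eq_norm_sq, hsn]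
    linarith
  · have hx0 : x z₂ = - x z₁ := by
      have h1 : s * (x z₁ + x z₂) = 0 := by
        have := hx
        rw [inner_add_left, EuclideanSpace.inner_single_left,
          EuclideanSpace.inner_single_left] at this
        rw [mul_add, ← this, hs, Complex.conj_ofReal]
      have h2 : s ≠ 0 := by
        intro h; rw [h] at hsn; norm_num at hsn
      have h3 := (mul_eq_zero.mp h1).resolve_left h2
      linear_combination h3
    set y : EuclideanSpace ℂ (Bits (Fin ℓ)) :=
      EuclideanSpace.single z₁ (x z₁) + EuclideanSpace.single z₂ (x z₂) with hy
    have hyz : ∀ z, y z = if z = z₁ ∨ z = z₂ then x z else 0 := by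
      intro z
      rw [hy, happ]
      by_cases h1 : z = z₁
      · simp [h1]
      · by_cases h2 : z = z₂ <;> simp [h1, h2, hne.symm]
    have hsplit : ∀ z, ‖x z‖ ^ 2 = ‖y z‖ ^ 2 + ‖(x - y) z‖ ^ 2 := by
      intro z
      rw [PiLp.sub_apply, hyz]
      split_ifs <;> simp
    refine ⟨y, x - y, by abel, ?_, ?_⟩
    · rw [EuclideanSpace.norm_sq_eq, EuclideanSpace.norm_sq_eq y,
        EuclideanSpace.norm_sq_eq (x - y), ← Finset.sum_add_distrib]
      exact Finset.sum_congr rfl fun z _ => hsplit z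
    · have hyn : ‖y‖ ^ 2 = 2 * ‖x z₁‖ ^ 2 := by
        have := hsum (x z₁) (x z₂) fun _ => 1
        simp only [one_mul] at this
        rw [← EuclideanSpace.norm_sq_eq, hx0, norm_neg] at this
        rw [hy, hx0, this]; ring
      have hyE : energy B y = 2 * f * ‖x z₁‖ ^ 2 := by
        rw [hy, energy_single_add_single B hB1 hB2 hB12 hB21, hx0, mul_neg (starRingEnd ℂ _),
          ← Complex.normSq_eq_conj_mul_self, Complex.neg_re, Complex.ofReal_re,
          Complex.normSq_eq_norm_sq]
        ring
      have hAy : ∑ z, E z * ‖y z‖ ^ 2 = (E z₁ + E z₂) * ‖x z₁‖ ^ 2 := by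
        rw [hy, hsum, hx0, norm_neg]; ring
      have hAx : ((E z₁ + E z₂) / 2 + μ) * ‖x - y‖ ^ 2 ≤ ∑ z, E z * ‖(x - y) z‖ ^ 2 := by
        rw [EuclideanSpace.norm_sq_eq, Finset.mul_sum]
        refine Finset.sum_le_sum fun z _ => ?_
        rw [PiLp.sub_apply, hyz]
        by_cases hz : z = z₁ ∨ z = z₂
        · simp [hz]
        · rw [if_neg hz]
          push Not at hz
          exact mul_le_mul_of_nonneg_right (hE z hz.1 hz.2) (sq_nonneg _)
      have hsumx : energy A x = ∑ z, E z * ‖y z‖ ^ 2 + ∑ z, E z * ‖(x - y) z‖ ^ 2 := by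
        rw [hA, energy_diagonal, ← Finset.sum_add_distrib]
        exact Finset.sum_congr rfl fun z _ => by rw [hsplit z]; ring
      rw [hsumx, hyE, hAy, hyn]
      nlinarith

/-- The weight of a low-energy state outside the low-energy configurations is small. -/
lemma sum_compl_norm_sq_le (E : Bits (Fin ℓ) → ℝ) {f μ : ℝ} (hf0 : 0 ≤ f) (hf2 : f ≤ 2)
    (hμ : 0 < μ) (S : Finset (Bits (Fin ℓ))) (e : ℝ) (h0 : ∀ z, e ≤ E z)
    (hS : ∀ z ∉ S, e + μ ≤ E z) (φ : EuclideanSpace ℂ (Bits (Fin ℓ))) (hφ : ‖φ‖ = 1)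
    (hle : energy ((Matrix.diagonal fun z => (E z : ℂ)) + f • XL ℓ) φ ≤ e) :
    ∑ z ∈ Sᶜ, ‖φ z‖ ^ 2 ≤ 2 * ℓ / μ := by
  rw [energy_add, energy_diagonal] at hle
  have h2 := (abs_le.mp (abs_energy_smul_XL_le hf0 hf2 φ)).1
  have h3 : e * ‖φ‖ ^ 2 + μ * ∑ z ∈ Sᶜ, ‖φ z‖ ^ 2 ≤ ∑ z, E z * ‖φ z‖ ^ 2 := by
    rw [EuclideanSpace.norm_sq_eq, ← Finset.sum_add_sum_compl S,
      ← Finset.sum_add_sum_compl S (fun z => E z * ‖φ z‖ ^ 2), mul_add, add_assoc, ← add_mul,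
      Finset.mul_sum, Finset.mul_sum]
    refine add_le_add (Finset.sum_le_sum fun z _ => ?_) (Finset.sum_le_sum fun z hz => ?_)
    · exact mul_le_mul_of_nonneg_right (h0 z) (sq_nonneg _)
    · exact mul_le_mul_of_nonneg_right (hS z (Finset.mem_compl.mp hz)) (sq_nonneg _)
  rw [hφ] at h2 h3
  rw [le_div_iff₀ hμ]
  linarith

lemma XL_clock_succ {k : ℕ} (hk : k < ℓ) :
    XL ℓ (clock ℓ ⟨k, by omega⟩) (clock ℓ ⟨k + 1, by omega⟩) = -1 ∧
      XL ℓ (clock ℓ ⟨k + 1, by omega⟩) (clock ℓ ⟨k, by omega⟩) = -1 := by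
  have h : ∀ u : Fin ℓ, (pauliX u : Op (Fin ℓ)) (clock ℓ ⟨k, by omega⟩) (clock ℓ ⟨k + 1, by omega⟩)
      = if u = ⟨k, hk⟩ then 1 else 0 := by
    intro u
    simp only [pauliX, Matrix.of_apply]
    congr 1
    simp only [eq_iff_iff]
    constructor
    · intro h
      by_contra hne
      have := congrFun h ⟨k, hk⟩
      rw [Function.update_of_ne (Ne.symm hne)] at this
      simp [clock] at this
    · rintro rfl
      ext i
      by_cases hi : i = ⟨k, hk⟩
      · subst hi; simp [clock]
      · have : (i : ℕ) ≠ k := fun h => hi (Fin.ext h)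
        rw [Function.update_of_ne hi]
        simp only [clock, decide_eq_decide]
        omega
  have h1 : XL ℓ (clock ℓ ⟨k, by omega⟩) (clock ℓ ⟨k + 1, by omega⟩) = -1 := by
    simp only [XL, Matrix.neg_apply, Matrix.sum_apply, h]
    simp
  refine ⟨h1, ?_⟩
  have := (XL_isHermitian ℓ).apply (clock ℓ ⟨k + 1, by omega⟩) (clock ℓ ⟨k, by omega⟩)
  rw [← this, h1]; simp

end ClockGround

section ClockInterpolation

/-- Testing the ground state inequality on the basis state at `z₀` bounds the energy of `φ` by `E
z₀`. Since the field gains at most `2ℓ`, little weight can lie where the diagonal energy is larger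
by `μ`. -/
lemma sum_compl_norm_sq_ground_le {ℓ : ℕ} (E : Bits (Fin ℓ) → ℝ) {f μ : ℝ} (hf0 : 0 ≤ f) (hf2 : f ≤ 2)
    (hμ : 0 < μ) (S : Finset (Bits (Fin ℓ))) (z₀ : Bits (Fin ℓ)) (h0 : ∀ z, E z₀ ≤ E z)
    (hS : ∀ z ∉ S, E z₀ + μ ≤ E z) (φ : EuclideanSpace ℂ (Bits (Fin ℓ))) (hφ : ‖φ‖ = 1)
    {δ : ℝ} (hδ : 0 ≤ δ)
    (hle : ∀ x, energy ((Matrix.diagonal fun z => (E z : ℂ)) + f • XL ℓ) φ * ‖x‖ ^ 2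
      + δ * (‖x‖ ^ 2 - ‖inner ℂ φ x‖ ^ 2)
      ≤ energy ((Matrix.diagonal fun z => (E z : ℂ)) + f • XL ℓ) x) :
    ∑ z ∈ Sᶜ, ‖φ z‖ ^ 2 ≤ 2 * ℓ / μ := by
  refine sum_compl_norm_sq_le E hf0 hf2 hμ S (E z₀) h0 hS φ hφ ?_
  have h1 := hle (EuclideanSpace.single z₀ 1)
  have h2 := norm_inner_le_norm (𝕜 := ℂ) φ (EuclideanSpace.single z₀ 1)
  rw [hφ] at h2
  rw [energy_single] at h1
  simp only [PiLp.norm_single, norm_one, one_pow, mul_one] at h1 h2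
  have h3 : ((Matrix.diagonal fun z => (E z : ℂ)) + f • XL ℓ) z₀ z₀ = E z₀ := by
    simp [XL_apply_self]
  rw [h3, Complex.ofReal_re] at h1
  have h4 : ‖inner ℂ φ (EuclideanSpace.single z₀ 1)‖ ^ 2 ≤ 1 :=
    pow_le_one₀ (norm_nonneg _) h2
  nlinarith

variable {ℓ : ℕ} [NeZero ℓ]

/-- The clock states on which the ground state of the clock is concentrated at time `t`. -/
def ClockConcentrated (t w : ℝ) (φ : EuclideanSpace ℂ (Bits (Fin ℓ))) : Prop :=
  (t ≤ 1 / 2 ∧ ∑ z ∈ ({clock ℓ 0} : Finset (Bits (Fin ℓ)))ᶜ, ‖φ z‖ ^ 2 ≤ w) ∨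
  (∃ k : Fin ℓ, 1 / 2 ≤ t ∧ t ≤ ℓ + 1 / 2 ∧
    ∑ z ∈ ({clock ℓ k.castSucc, clock ℓ k.succ} : Finset (Bits (Fin ℓ)))ᶜ, ‖φ z‖ ^ 2 ≤ w) ∨
  ((ℓ : ℝ) + 1 / 2 ≤ t ∧
    ∑ z ∈ ({clock ℓ (Fin.last ℓ)} : Finset (Bits (Fin ℓ)))ᶜ, ‖φ z‖ ^ 2 ≤ w)

/-- Reduces a comparison with all strings to one between points of the parabola: on other strings
the wall penalty `4 * ΔL` outweighs any variation of the tilt. -/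
lemma clockPotential_clock_add_le {ΔL ε t : ℝ} (hε : 0 < ε) {k : Fin (ℓ + 1)} {δ : ℝ}
    {T : ℝ} (hT : |t| ≤ T) (hΔ : (4 * ℓ * (ℓ + T) + δ) / ε ≤ 4 * ΔL) (hΔL : 0 ≤ ΔL)
    (z : Bits (Fin ℓ))
    (h : ∀ j : Fin (ℓ + 1), z = clock ℓ j →
      (k : ℕ) * ((k : ℕ) + 1 - 2 * t) + δ ≤ (j : ℕ) * ((j : ℕ) + 1 - 2 * t)) :
    clockPotential ℓ ΔL ε t (clock ℓ k) + δ / ε ≤ clockPotential ℓ ΔL ε t z := by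
  by_cases hz : ∃ j, z = clock ℓ j
  · obtain ⟨j, rfl⟩ := hz
    rw [clockPotential_clock, clockPotential_clock, ← add_div]
    gcongr
    exact h j rfl
  · push Not at hz
    have h1 := four_le_wallPotential ℓ hz
    have h2 := (abs_le.mp (abs_tiltPotential_le ℓ hT z)).1
    have h3 := (abs_le.mp (abs_tiltPotential_le ℓ hT (clock ℓ k))).2
    rw [clockPotential, clockPotential, wallPotential_clock, mul_zero, zero_add, ← add_div]
    have h4 : (tiltPotential ℓ t (clock ℓ k) + δ) / ε - tiltPotential ℓ t z / ε
        ≤ (4 * ℓ * (ℓ + T) + δ) / ε := by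
      rw [← sub_div]
      gcongr
      linarith
    have h5 : 4 * ΔL ≤ ΔL * wallPotential ℓ z := by nlinarith
    linarith

lemma exists_nat_near {t : ℝ} (h1 : 1 / 2 ≤ t) (h2 : t ≤ ℓ + 1 / 2) :
    ∃ k < ℓ, 2 * (k : ℝ) + 1 ≤ 2 * t ∧ 2 * t ≤ 2 * k + 3 := by
  have hℓ : 1 ≤ ℓ := Nat.one_le_iff_ne_zero.mpr (NeZero.ne ℓ)
  by_cases h : ⌊t - 1 / 2⌋₊ < ℓ
  · refine ⟨_, h, ?_, ?_⟩
    · linarith [Nat.floor_le (show 0 ≤ t - 1 / 2 by linarith)]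
    · linarith [Nat.lt_floor_add_one (t - 1 / 2)]
  -- Only `t = ℓ + 1/2` lands here: the floor is then `ℓ`, and the last pair has to be used.
  · refine ⟨ℓ - 1, by omega, ?_, ?_⟩
    · have h3 := (Nat.le_floor_iff (show 0 ≤ t - 1 / 2 by linarith)).mp (not_lt.mp h)
      push_cast [hℓ]; linarith
    · push_cast [hℓ]; linarith

/-- For `t ≤ 1/2` or `t ≥ ℓ + 1/2` an end of the clock lies `1 / ε` below everything else. In
between, the two clock states `k`, `k + 1` with `k + 1/2 ≤ t ≤ k + 3/2` are the lowest; only there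
must the field be at least `1/2`. -/
lemma exists_clock_ground {ΔL ε f t T : ℝ} (hε : 0 < ε) (hεℓ : 20 * (ℓ : ℝ) ^ 2 ≤ 1 / ε)
    (hT : |t| ≤ T) (hΔ : (4 * ℓ * (ℓ + T) + 1) / ε ≤ 4 * ΔL) (hf0 : 0 ≤ f) (hf2 : f ≤ 2)
    (hf : t ≤ ℓ + 1 / 2 → 1 / 2 ≤ f) :
    ∃ φ : EuclideanSpace ℂ (Bits (Fin ℓ)), ‖φ‖ = 1 ∧
      (∀ x, energy (QL ℓ ΔL + f • XL ℓ + ZL ℓ ε t) φ * ‖x‖ ^ 2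
        + 1 / 2 * (‖x‖ ^ 2 - ‖inner ℂ φ x‖ ^ 2) ≤ energy (QL ℓ ΔL + f • XL ℓ + ZL ℓ ε t) x) ∧
      ClockConcentrated t (2 * ℓ * ε) φ := by
  have hℓ : (1 : ℝ) ≤ ℓ := by exact_mod_cast Nat.one_le_iff_ne_zero.mpr (NeZero.ne ℓ)
  have hT0 : 0 ≤ T := (abs_nonneg t).trans hT
  have hΔL : 0 ≤ ΔL := by
    have : 0 ≤ (4 * ℓ * (ℓ + T) + 1) / ε := by positivity
    linarith
  rw [add_right_comm, QL_add_ZL]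
  set E := clockPotential ℓ ΔL ε t with hE
  have hherm : ((Matrix.diagonal fun z => (E z : ℂ)) + f • XL ℓ).IsHermitian :=
    (isHermitian_diagonal_ofReal E).add (isHermitian_real_smul (XL_isHermitian ℓ) f)
  have hε1 : 0 < 1 / ε := by positivity
  have hw : 2 * (ℓ : ℝ) / (1 / ε) = 2 * ℓ * ε := by field_simp
  have hμ : 2 * (ℓ : ℝ) + 1 / 2 ≤ 1 / ε := by nlinarith
  have single : ∀ k : Fin (ℓ + 1), (∀ j : Fin (ℓ + 1), j ≠ k →
      ((k : ℕ) : ℝ) * ((k : ℕ) + 1 - 2 * t) + 1 ≤ (j : ℕ) * ((j : ℕ) + 1 - 2 * t)) →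
      ∃ φ : EuclideanSpace ℂ (Bits (Fin ℓ)), ‖φ‖ = 1 ∧
      (∀ x, energy ((Matrix.diagonal fun z => (E z : ℂ)) + f • XL ℓ) φ * ‖x‖ ^ 2
        + 1 / 2 * (‖x‖ ^ 2 - ‖inner ℂ φ x‖ ^ 2)
          ≤ energy ((Matrix.diagonal fun z => (E z : ℂ)) + f • XL ℓ) x) ∧
      ∑ z ∈ ({clock ℓ k} : Finset (Bits (Fin ℓ)))ᶜ, ‖φ z‖ ^ 2 ≤ 2 * ℓ * ε := by
    intro k hk
    have hiso : ∀ z, z ≠ clock ℓ k → E (clock ℓ k) + 1 / ε ≤ E z := fun z hz =>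
      clockPotential_clock_add_le hε hT hΔ hΔL z fun j hj => hk j fun h => hz (by rw [hj, h])
    obtain ⟨φ, hφ, hg⟩ := exists_ground hherm (two_le_card_bits ℓ)
      (half_le_spectralGap_of_isolated E hf0 hf2 hμ (clock ℓ k) hiso)
    refine ⟨φ, hφ, hg, ?_⟩
    rw [← hw]
    refine sum_compl_norm_sq_ground_le E hf0 hf2 hε1 _ (clock ℓ k) (fun z => ?_)
      (fun z hz => hiso z (by simpa using hz)) φ hφ (by norm_num) hg
    by_cases hz : z = clock ℓ k
    · rw [hz]
    · linarith [hiso z hz]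
  by_cases h1 : t ≤ 1 / 2
  · obtain ⟨φ, hφ, hg, hwt⟩ := single 0 (fun j hj => by
      have : (1 : ℝ) ≤ (j : ℕ) := by
        exact_mod_cast Nat.one_le_iff_ne_zero.mpr fun h => hj (Fin.ext h)
      simp only [Fin.val_zero, Nat.cast_zero]
      nlinarith)
    exact ⟨φ, hφ, hg, Or.inl ⟨h1, hwt⟩⟩
  by_cases h2 : (ℓ : ℝ) + 1 / 2 ≤ t
  · obtain ⟨φ, hφ, hg, hwt⟩ := single (Fin.last ℓ) (fun j hj => by
      have h3 : (j : ℕ) + 1 ≤ ℓ := by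
        have := j.2
        have h4 : (j : ℕ) ≠ ℓ := fun h => hj (Fin.ext h)
        omega
      have h3 : ((j : ℕ) : ℝ) + 1 ≤ ℓ := by exact_mod_cast h3
      simp only [Fin.val_last]
      nlinarith)
    exact ⟨φ, hφ, hg, Or.inr (Or.inr ⟨h2, hwt⟩)⟩
  push Not at h1 h2
  obtain ⟨k, hk, hk1, hk2⟩ := exists_nat_near (ℓ := ℓ) h1.le h2.le
  have hcases : ∀ j : Fin (ℓ + 1), j ≠ (⟨k, hk⟩ : Fin ℓ).castSucc → j ≠ (⟨k, hk⟩ : Fin ℓ).succ →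
      ((j : ℕ) : ℝ) + 1 ≤ k ∨ (k : ℝ) + 2 ≤ (j : ℕ) := by
    intro j hj1 hj2
    have h3 : (j : ℕ) ≠ k := fun h => hj1 (Fin.ext h)
    have h4 : (j : ℕ) ≠ k + 1 := fun h => hj2 (Fin.ext h)
    have : (j : ℕ) + 1 ≤ k ∨ k + 2 ≤ (j : ℕ) := by omega
    exact_mod_cast this
  have hmem : ∀ z ∉ ({clock ℓ (⟨k, hk⟩ : Fin ℓ).castSucc, clock ℓ (⟨k, hk⟩ : Fin ℓ).succ}
      : Finset (Bits (Fin ℓ))), ∀ j, z = clock ℓ j →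
      ((j : ℕ) : ℝ) + 1 ≤ k ∨ (k : ℝ) + 2 ≤ (j : ℕ) := by
    intro z hz j hj
    simp only [Finset.mem_insert, Finset.mem_singleton, not_or] at hz
    exact hcases j (fun h => hz.1 (by rw [hj, h])) (fun h => hz.2 (by rw [hj, h]))
  -- `p` is the lower state of the pair. The two energies differ by at most `1 / ε`, so their mean
  -- is at most `1 / (2ε)` above `p`, which leaves `1 / (2ε)` between the mean and all other states.
  obtain ⟨p, hp0, hp1, hp2⟩ : ∃ p : Fin (ℓ + 1), (∀ z, E (clock ℓ p) ≤ E z) ∧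
      (∀ z ∉ ({clock ℓ (⟨k, hk⟩ : Fin ℓ).castSucc, clock ℓ (⟨k, hk⟩ : Fin ℓ).succ}
        : Finset (Bits (Fin ℓ))), E (clock ℓ p) + 1 / ε ≤ E z) ∧
      (E (clock ℓ (⟨k, hk⟩ : Fin ℓ).castSucc) + E (clock ℓ (⟨k, hk⟩ : Fin ℓ).succ)) / 2
        ≤ E (clock ℓ p) + 1 / (2 * ε) := by
    have hsplit : ∀ p : Fin (ℓ + 1), (∀ z ∉ ({clock ℓ (⟨k, hk⟩ : Fin ℓ).castSucc,
        clock ℓ (⟨k, hk⟩ : Fin ℓ).succ} : Finset (Bits (Fin ℓ))), E (clock ℓ p) + 1 / ε ≤ E z) →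
        E (clock ℓ p) ≤ E (clock ℓ (⟨k, hk⟩ : Fin ℓ).castSucc) →
        E (clock ℓ p) ≤ E (clock ℓ (⟨k, hk⟩ : Fin ℓ).succ) → ∀ z, E (clock ℓ p) ≤ E z := by
      intro p h h3 h4 z
      by_cases hz : z ∈ ({clock ℓ (⟨k, hk⟩ : Fin ℓ).castSucc, clock ℓ (⟨k, hk⟩ : Fin ℓ).succ}
        : Finset (Bits (Fin ℓ)))
      · simp only [Finset.mem_insert, Finset.mem_singleton] at hz
        rcases hz with rfl | rfl <;> assumption
      · linarith [h z hz]
    have hEk : E (clock ℓ (⟨k, hk⟩ : Fin ℓ).castSucc) = k * (k + 1 - 2 * t) / ε := by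
      rw [hE, clockPotential_clock]; simp
    have hEk' : E (clock ℓ (⟨k, hk⟩ : Fin ℓ).succ) = (k + 1) * (k + 2 - 2 * t) / ε := by
      rw [hE, clockPotential_clock]; simp; ring
    have hhalf : 1 / (2 * ε) = 1 / 2 / ε := by field_simp
    rcases le_total (2 * t) (2 * k + 2) with h3 | h3
    · have hout : ∀ z ∉ ({clock ℓ (⟨k, hk⟩ : Fin ℓ).castSucc,
        clock ℓ (⟨k, hk⟩ : Fin ℓ).succ} : Finset (Bits (Fin ℓ))),
          E (clock ℓ (⟨k, hk⟩ : Fin ℓ).castSucc) + 1 / ε ≤ E z := fun z hz =>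
        clockPotential_clock_add_le hε hT hΔ hΔL z fun j hj => by
          simp only [Fin.val_castSucc]
          rcases hmem z hz j hj with h4 | h4 <;> nlinarith
      refine ⟨_, hsplit _ hout le_rfl ?_, hout, ?_⟩
      · rw [hEk, hEk']; exact div_le_div_of_nonneg_right (by linarith) hε.le
      · rw [hEk, hEk', ← add_div, hhalf, ← add_div, div_right_comm]
        exact div_le_div_of_nonneg_right (by linarith) hε.le
    · have hout : ∀ z ∉ ({clock ℓ (⟨k, hk⟩ : Fin ℓ).castSucc,
        clock ℓ (⟨k, hk⟩ : Fin ℓ).succ} : Finset (Bits (Fin ℓ))),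
          E (clock ℓ (⟨k, hk⟩ : Fin ℓ).succ) + 1 / ε ≤ E z := fun z hz =>
        clockPotential_clock_add_le hε hT hΔ hΔL z fun j hj => by
          simp only [Fin.val_succ, Nat.cast_add, Nat.cast_one]
          rcases hmem z hz j hj with h4 | h4 <;> nlinarith
      refine ⟨_, hsplit _ hout ?_ le_rfl, hout, ?_⟩
      · rw [hEk, hEk']; exact div_le_div_of_nonneg_right (by linarith) hε.le
      · rw [hEk, hEk', ← add_div, hhalf, ← add_div, div_right_comm]
        exact div_le_div_of_nonneg_right (by linarith) hε.le
  have hX := XL_clock_succ hk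
  have h2ε : 1 / (2 * ε) = 1 / ε / 2 := by field_simp
  obtain ⟨φ, hφ, hg⟩ := exists_ground hherm (two_le_card_bits ℓ)
    (half_le_spectralGap_of_isolated_pair E (μ := 1 / (2 * ε)) (hf h2.le) hf2
      (by rw [h2ε]; linarith)
      (z₁ := clock ℓ (⟨k, hk⟩ : Fin ℓ).castSucc) (z₂ := clock ℓ (⟨k, hk⟩ : Fin ℓ).succ)
      (fun h => by have := congrArg Fin.val (clock_injective ℓ h); simp at this) hX.1 hX.2
      (fun z hz1 hz2 => by
        have := hp1 z (by
          rw [Finset.mem_insert, Finset.mem_singleton]; exact not_or.mpr ⟨hz1, hz2⟩)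
        rw [h2ε] at hp2 ⊢
        linarith))
  refine ⟨φ, hφ, hg, Or.inr (Or.inl ⟨⟨k, hk⟩, h1.le, h2.le, ?_⟩)⟩
  rw [← hw]
  exact sum_compl_norm_sq_ground_le E hf0 hf2 hε1 _ (clock ℓ p) hp0 hp1 φ hφ (by norm_num) hg

end ClockInterpolation

/-! ### Tensor products and freezing of the clock -/

section Tensor

variable {ι κ : Type}

/-- The product vector `v ⊗ φ`. -/
def tensorVec (v : EuclideanSpace ℂ ι) (φ : EuclideanSpace ℂ κ) : EuclideanSpace ℂ (ι × κ) :=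
  WithLp.toLp 2 fun p => v p.1 * φ p.2

/-- The component `⟨i| ⊗ I` of a vector. -/
def slice (x : EuclideanSpace ℂ (ι × κ)) (i : ι) : EuclideanSpace ℂ κ :=
  WithLp.toLp 2 fun k => x (i, k)

lemma slice_tensorVec (v : EuclideanSpace ℂ ι) (φ : EuclideanSpace ℂ κ) (i : ι) :
    slice (tensorVec v φ) i = v i • φ := by
  ext k; simp [slice, tensorVec]

variable [Fintype ι] [Fintype κ]

lemma sum_norm_sq_slice (x : EuclideanSpace ℂ (ι × κ)) : ‖x‖ ^ 2 = ∑ i, ‖slice x i‖ ^ 2 := by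
  simp only [EuclideanSpace.norm_sq_eq, Fintype.sum_prod_type, slice]

lemma norm_sq_tensorVec (v : EuclideanSpace ℂ ι) (φ : EuclideanSpace ℂ κ) :
    ‖tensorVec v φ‖ ^ 2 = ‖v‖ ^ 2 * ‖φ‖ ^ 2 := by
  rw [sum_norm_sq_slice, EuclideanSpace.norm_sq_eq v, Finset.sum_mul]
  exact Finset.sum_congr rfl fun i _ => by rw [slice_tensorVec, norm_smul, mul_pow]

/-- The partial inner product `(I ⊗ ⟨φ|) x`. -/
def contract (φ : EuclideanSpace ℂ κ) (x : EuclideanSpace ℂ (ι × κ)) : EuclideanSpace ℂ ι :=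
  WithLp.toLp 2 fun i => inner ℂ φ (slice x i)

lemma inner_tensorVec (v : EuclideanSpace ℂ ι) (φ : EuclideanSpace ℂ κ)
    (x : EuclideanSpace ℂ (ι × κ)) : inner ℂ (tensorVec v φ) x = inner ℂ v (contract φ x) := by
  simp only [PiLp.inner_apply, contract, tensorVec, slice, Fintype.sum_prod_type, RCLike.inner_apply,
    map_mul, Finset.sum_mul]
  exact Finset.sum_congr rfl fun i _ => Finset.sum_congr rfl fun k _ => by ring

variable [DecidableEq ι] [DecidableEq κ]

lemma energy_one_kronecker (C : Matrix κ κ ℂ) (x : EuclideanSpace ℂ (ι × κ)) :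
    energy ((1 : Matrix ι ι ℂ) ⊗ₖ C) x = ∑ i, energy C (slice x i) := by
  simp only [energy, ← Complex.re_sum]
  congr 1
  simp only [PiLp.inner_apply, Fintype.sum_prod_type, Matrix.ofLp_toEuclideanCLM, slice,
    Matrix.mulVec, dotProduct, Matrix.kronecker_apply, Matrix.one_apply]
  simp

lemma inner_kronecker_tensorVec (M : Matrix ι ι ℂ) (N : Matrix κ κ ℂ) (v : EuclideanSpace ℂ ι)
    (φ : EuclideanSpace ℂ κ) :
    inner ℂ (tensorVec v φ) (Matrix.toEuclideanCLM (n := ι × κ) (𝕜 := ℂ) (M ⊗ₖ N) (tensorVec v φ))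
      = inner ℂ v (Matrix.toEuclideanCLM (n := ι) (𝕜 := ℂ) M v)
        * inner ℂ φ (Matrix.toEuclideanCLM (n := κ) (𝕜 := ℂ) N φ) := by
  have h : Matrix.toEuclideanCLM (n := ι × κ) (𝕜 := ℂ) (M ⊗ₖ N) (tensorVec v φ)
      = tensorVec (Matrix.toEuclideanCLM (n := ι) (𝕜 := ℂ) M v)
        (Matrix.toEuclideanCLM (n := κ) (𝕜 := ℂ) N φ) := by
    ext ⟨p, q⟩
    simp only [Matrix.ofLp_toEuclideanCLM, tensorVec, Matrix.mulVec, dotProduct,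
      Matrix.kronecker_apply, Fintype.sum_prod_type, Finset.sum_mul_sum]
    exact Finset.sum_congr rfl fun i _ => Finset.sum_congr rfl fun k _ => by ring
  rw [h]
  simp only [PiLp.inner_apply, tensorVec, Fintype.sum_prod_type, RCLike.inner_apply, map_mul,
    Finset.sum_mul_sum]
  exact Finset.sum_congr rfl fun i _ => Finset.sum_congr rfl fun k _ => by ring

lemma energy_kronecker_one_tensorVec (M : Matrix ι ι ℂ) (v : EuclideanSpace ℂ ι)
    (φ : EuclideanSpace ℂ κ) :
    energy (M ⊗ₖ (1 : Matrix κ κ ℂ)) (tensorVec v φ) = energy M v * ‖φ‖ ^ 2 := by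
  rw [energy, inner_kronecker_tensorVec, map_one, one_apply_eq_self,
    inner_self_eq_norm_sq_to_K, energy]
  norm_cast
  exact Complex.re_mul_ofReal _ _

lemma energy_kronecker_single_tensorVec (M : Matrix ι ι ℂ) (k : κ) (v : EuclideanSpace ℂ ι)
    (φ : EuclideanSpace ℂ κ) :
    energy (M ⊗ₖ Matrix.single k k (1 : ℂ)) (tensorVec v φ) = ‖φ k‖ ^ 2 * energy M v := by
  have h : inner ℂ φ (Matrix.toEuclideanCLM (n := κ) (𝕜 := ℂ) (Matrix.single k k (1 : ℂ)) φ)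
      = ((‖φ k‖ ^ 2 : ℝ) : ℂ) := by
    rw [← Matrix.diagonal_single]
    simp only [PiLp.inner_apply, Matrix.ofLp_toEuclideanCLM, Matrix.mulVec_diagonal]
    rw [Finset.sum_eq_single k]
    · simp
    · intro j _ hj; simp [hj]
    · simp
  rw [energy, inner_kronecker_tensorVec, h, energy, Complex.re_mul_ofReal, mul_comm]

/-- A large multiple of a gapped Hamiltonian on the second register freezes that register in its
ground state `φ`; the gap is then at least half of the gap of the effective Hamiltonian. -/
lemma half_le_spectralGap_of_frozen {C : Matrix κ κ ℂ} {B : Matrix (ι × κ) (ι × κ) ℂ}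
    (hC : C.IsHermitian) (hB : B.IsHermitian) (hc : 2 ≤ Fintype.card (ι × κ)) {Δ γ δ R : ℝ}
    (hΔ : 0 ≤ Δ) (hδ : 0 < δ) (hR : opNorm B ≤ R)
    (hM : R ^ 2 ≤ (Δ * γ - 2 * R - δ / 2) * (δ / 2))
    (φ : EuclideanSpace ℂ κ) (hφ : ‖φ‖ = 1)
    (hground : ∀ x, energy C φ * ‖x‖ ^ 2 + γ * (‖x‖ ^ 2 - ‖inner ℂ φ x‖ ^ 2) ≤ energy C x)
    (g : EuclideanSpace ℂ ι) (hg : ‖g‖ = 1)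
    (heff : ∀ v, inner ℂ g v = 0 →
      (energy B (tensorVec g φ) + δ) * ‖v‖ ^ 2 ≤ energy B (tensorVec v φ)) :
    δ / 2 ≤ spectralGap (Δ • ((1 : Matrix ι ι ℂ) ⊗ₖ C) + B) := by
  have hgφ : ‖tensorVec g φ‖ ^ 2 = 1 := by rw [norm_sq_tensorVec, hg, hφ]; norm_num
  have hb : energy B (tensorVec g φ) ≤ R := by
    have := (abs_le.mp (abs_energy_le B (tensorVec g φ))).2
    rw [hgφ] at this
    linarith
  -- Vectors orthogonal to all `v ⊗ φ` cost `Δ * γ` relative to the clock ground energy alone; as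
  -- `e` also contains an energy of `B` of at most `R`, the excess over `e` is `Δ * γ - R`.
  refine half_le_spectralGap_of_split (e := Δ * energy C φ + energy B (tensorVec g φ))
    (M := Δ * γ - R) (R := R)
    (isHermitian_real_smul (isHermitian_kronecker Matrix.isHermitian_one hC) Δ) hB hc hδ hR
    (by linarith) (tensorVec g φ) ?_ ?_ fun x hx => ?_
  · nlinarith [norm_nonneg (tensorVec g φ)]
  · rw [energy_smul, energy_one_kronecker]
    have : ∑ i, energy C (slice (tensorVec g φ) i) = energy C φ := by
      have h1 : ∀ i, energy C (slice (tensorVec g φ) i) = ‖g i‖ ^ 2 * energy C φ := by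
        intro i
        rw [slice_tensorVec, energy, map_smul, inner_smul_left, inner_smul_right, ← mul_assoc,
          Complex.conj_mul']
        norm_cast
        rw [Complex.re_ofReal_mul, energy]
      rw [Finset.sum_congr rfl fun i _ => h1 i, ← Finset.sum_mul, ← EuclideanSpace.norm_sq_eq, hg]
      simp
    rw [this]
  -- `v ⊗ φ` is the orthogonal projection of `x` to the frozen subspace, and `v` inherits
  -- orthogonality to `g`.
  · set v := contract φ x with hv
    have hgv : inner ℂ g v = 0 := by rw [hv, ← inner_tensorVec, hx]
    have hvi : ∀ i, v i = inner ℂ φ (slice x i) := fun i => rfl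
    have hslice : ∀ i, ‖slice x i‖ ^ 2 = ‖v i‖ ^ 2 + ‖slice (x - tensorVec v φ) i‖ ^ 2 := by
      intro i
      have h1 : slice (x - tensorVec v φ) i = slice x i - v i • φ := by
        rw [← slice_tensorVec]; rfl
      have h2 : inner ℂ (v i • φ) (slice x i - v i • φ) = 0 := by
        rw [inner_smul_left, inner_sub_right, inner_smul_right, ← hvi,
          inner_self_eq_norm_sq_to_K, hφ]
        simp
      have h3 := norm_add_sq_eq_norm_sq_add_norm_sq_of_inner_eq_zero _ _ h2
      rw [add_sub_cancel] at h3
      rw [h1]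
      have h4 : ‖v i • φ‖ = ‖v i‖ := by rw [norm_smul, hφ, mul_one]
      rw [h4] at h3
      nlinarith
    have hny : ‖tensorVec v φ‖ ^ 2 = ‖v‖ ^ 2 := by rw [norm_sq_tensorVec, hφ]; norm_num
    have hnorm : ‖x‖ ^ 2 = ‖tensorVec v φ‖ ^ 2 + ‖x - tensorVec v φ‖ ^ 2 := by
      rw [hny, sum_norm_sq_slice, sum_norm_sq_slice (x - tensorVec v φ), EuclideanSpace.norm_sq_eq v,
        ← Finset.sum_add_distrib]
      exact Finset.sum_congr rfl fun i _ => hslice i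
    refine ⟨tensorVec v φ, x - tensorVec v φ, by abel, hnorm, ?_⟩
    have h1 : energy C φ * ‖x‖ ^ 2 + γ * ‖x - tensorVec v φ‖ ^ 2
        ≤ energy ((1 : Matrix ι ι ℂ) ⊗ₖ C) x := by
      rw [energy_one_kronecker, sum_norm_sq_slice x, sum_norm_sq_slice (x - tensorVec v φ),
        Finset.mul_sum, Finset.mul_sum, ← Finset.sum_add_distrib]
      refine Finset.sum_le_sum fun i _ => ?_
      have := hground (slice x i)
      rw [← hvi] at this
      have h2 := hslice i
      have h3 : ‖slice (x - tensorVec v φ) i‖ ^ 2 = ‖slice x i‖ ^ 2 - ‖v i‖ ^ 2 := by linarith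
      rw [h3]
      exact this
    have h2 := heff v hgv
    rw [energy_smul]
    have h3 := mul_le_mul_of_nonneg_left h1 hΔ
    rw [hnorm] at h3
    rw [hny] at h3 ⊢
    nlinarith [sq_nonneg ‖x - tensorVec v φ‖]

end Tensor

/-! ### The effective Hamiltonian of the first register -/

section Effective

variable {nB ℓ : ℕ}

lemma DC_isHermitian {D : Fin (ℓ + 1) → Op (Fin nB)} (hD : ∀ i, (D i).IsHermitian) :
    (DC D).IsHermitian := by
  refine isHermitian_sum _ fun i => isHermitian_kronecker (hD i) ?_
  rw [Matrix.IsHermitian, Matrix.conjTranspose_single, star_one]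

/-- The Hamiltonian on the first register seen when the clock is in the state `φ`. -/
def effective (ΔB : ℝ) (D : Fin (ℓ + 1) → Op (Fin nB)) (a b : ℝ) (p : Fin (ℓ + 1) → ℝ) :
    Op (Fin nB) :=
  a • XB nB ΔB + b • ∑ j, p j • D j

lemma energy_tensorVec_eq_effective (ΔB : ℝ) (D : Fin (ℓ + 1) → Op (Fin nB)) (a b : ℝ)
    (v : EuclideanSpace ℂ (Bits (Fin nB))) {φ : EuclideanSpace ℂ (Bits (Fin ℓ))} (hφ : ‖φ‖ = 1) :
    energy (a • (XB nB ΔB ⊗ₖ (1 : Op (Fin ℓ))) + b • DC D) (tensorVec v φ)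
      = energy (effective ΔB D a b fun j => ‖φ (clock ℓ j)‖ ^ 2) v := by
  simp only [effective, DC, energy_add, energy_smul, energy_sum, energy_kronecker_one_tensorVec,
    energy_kronecker_single_tensorVec, hφ]
  simp

/-- The ground vector of the reference `K` is the trial vector, so no gap of the effective
Hamiltonian itself is needed. The error `κ` enters twice, once at the trial vector and once on its
complement. -/
lemma half_le_spectralGap_of_near [NeZero nB] {ΔB : ℝ}
    {D : Fin (ℓ + 1) → Op (Fin nB)} (hD : ∀ i, (D i).IsHermitian) {C : Op (Fin ℓ)}
    (hC : C.IsHermitian) {a b Δ γ δ R κ : ℝ} (hΔ : 0 ≤ Δ) (hδ : 0 < δ)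
    (hR : opNorm (a • (XB nB ΔB ⊗ₖ (1 : Op (Fin ℓ))) + b • DC D) ≤ R)
    (hM : R ^ 2 ≤ (Δ * γ - 2 * R - δ / 2) * (δ / 2))
    (φ : EuclideanSpace ℂ (Bits (Fin ℓ))) (hφ : ‖φ‖ = 1)
    (hground : ∀ x, energy C φ * ‖x‖ ^ 2 + γ * (‖x‖ ^ 2 - ‖inner ℂ φ x‖ ^ 2) ≤ energy C x)
    {K : Op (Fin nB)} (hK : K.IsHermitian) (hgap : δ + 2 * κ ≤ spectralGap K)
    (hκ : opNorm (effective ΔB D a b (fun j => ‖φ (clock ℓ j)‖ ^ 2) - K) ≤ κ) :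
    δ / 2 ≤ spectralGap (Δ • ((1 : Op (Fin nB)) ⊗ₖ C)
      + (a • (XB nB ΔB ⊗ₖ (1 : Op (Fin ℓ))) + b • DC D)) := by
  obtain ⟨g, hg, hmin⟩ := exists_ground hK (two_le_card_bits nB) hgap
  have hBh : (a • (XB nB ΔB ⊗ₖ (1 : Op (Fin ℓ))) + b • DC D).IsHermitian :=
    (isHermitian_real_smul (isHermitian_kronecker (XB_isHermitian nB ΔB)
      Matrix.isHermitian_one) a).add (isHermitian_real_smul (DC_isHermitian hD) b)
  have hcard : 2 ≤ Fintype.card (Bits (Fin nB) × Bits (Fin ℓ)) := by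
    rw [Fintype.card_prod]
    have h1 := two_le_card_bits nB
    have h2 : 0 < Fintype.card (Bits (Fin ℓ)) := Fintype.card_pos
    nlinarith
  refine half_le_spectralGap_of_frozen hC hBh hcard hΔ hδ hR hM φ hφ hground g hg fun v hv => ?_
  rw [energy_tensorVec_eq_effective ΔB D a b _ hφ, energy_tensorVec_eq_effective ΔB D a b _ hφ]
  have h1 : ∀ x, |energy (effective ΔB D a b fun j => ‖φ (clock ℓ j)‖ ^ 2) x - energy K x|
      ≤ κ * ‖x‖ ^ 2 := by
    intro x
    rw [← energy_sub]
    exact (abs_energy_le _ _).trans (by gcongr)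
  have h2 := (abs_le.mp (h1 g)).2
  have h3 := (abs_le.mp (h1 v)).1
  have h4 := hmin v
  rw [hv] at h4
  rw [hg] at h2
  simp only [norm_zero] at h4
  nlinarith [sq_nonneg ‖v‖]

end Effective

/-! ### Transverse field Ising form on the joint register -/

section JoinRegisters

variable {V W : Type} [Fintype V] [Fintype W]

lemma joinRegisters_one_kronecker_diagonal (d : Bits W → ℂ) :
    joinRegisters ((1 : Op V) ⊗ₖ (Matrix.diagonal d : Op W))
      = Matrix.diagonal fun x => d fun w => x (Sum.inr w) := by
  rw [joinRegisters, ← Matrix.diagonal_one, Matrix.diagonal_kronecker_diagonal,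
    Matrix.submatrix_diagonal_equiv]
  congr 1
  ext x; simp [Function.comp_def, Equiv.sumArrowEquivProdArrow]

lemma joinRegisters_one : joinRegisters (1 : Matrix (Bits V × Bits W) (Bits V × Bits W) ℂ) = 1 :=
  Matrix.submatrix_one_equiv _

end JoinRegisters

section TransverseFieldIsing

variable {V : Type} [Fintype V] [DecidableEq V]

lemma IsTFI.add {A B : Op V} (hA : IsTFI A) (hB : IsTFI B) : IsTFI (A + B) := by
  obtain ⟨e, h, g, J, rfl⟩ := hA
  obtain ⟨e', h', g', J', rfl⟩ := hB
  refine ⟨e + e', h + h', g + g', J + J', ?_⟩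
  simp only [Pi.add_apply, add_smul, Finset.sum_add_distrib]
  abel

lemma IsTFI.smul {A : Op V} (r : ℝ) (hA : IsTFI A) : IsTFI (r • A) := by
  obtain ⟨e, h, g, J, rfl⟩ := hA
  refine ⟨r * e, r • h, r • g, r • J, ?_⟩
  simp only [Pi.smul_apply, smul_eq_mul, mul_smul, smul_add, Finset.smul_sum]

lemma isTFI_one : IsTFI (1 : Op V) := ⟨1, 0, 0, 0, by simp⟩

lemma isTFI_zero : IsTFI (0 : Op V) := ⟨0, 0, 0, 0, by simp⟩

lemma isTFI_pauliX (u : V) : IsTFI (pauliX u) :=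
  ⟨0, Pi.single u 1, 0, 0, by simp [Pi.single_apply, ite_smul]⟩

lemma isTFI_pauliZ (u : V) : IsTFI (pauliZ u) :=
  ⟨0, 0, Pi.single u 1, 0, by simp [Pi.single_apply, ite_smul]⟩

lemma isTFI_pauliZ_mul_pauliZ {u v : V} (h : v ≠ u) : IsTFI (pauliZ u * pauliZ v) := by
  refine ⟨0, 0, 0, fun a b => if a = u ∧ b = v then 1 else 0, ?_⟩
  simp only [zero_smul, Pi.zero_apply, add_zero, Finset.sum_const_zero, zero_add]
  rw [Finset.sum_eq_single u, Finset.sum_eq_single v]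
  · simp
  · intro b _ hb; simp [hb]
  · simp [h]
  · intro a _ ha; simp [ha]
  · simp

lemma IsTFI.neg {A : Op V} (hA : IsTFI A) : IsTFI (-A) := by
  simpa using hA.smul (-1)

lemma IsTFI.sub {A B : Op V} (hA : IsTFI A) (hB : IsTFI B) : IsTFI (A - B) := by
  rw [sub_eq_add_neg]; exact hA.add hB.neg

lemma isTFI_sum {κ : Type} (s : Finset κ) {A : κ → Op V} (h : ∀ k, IsTFI (A k)) :
    IsTFI (∑ k ∈ s, A k) := by
  classical
  induction s using Finset.induction_on with
  | empty => simpa using isTFI_zero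
  | insert a s ha ih => rw [Finset.sum_insert ha]; exact (h a).add ih

variable {W : Type} [Fintype W] [DecidableEq W]

lemma joinRegisters_pauliX_kronecker_one (u : V) :
    joinRegisters ((pauliX u : Op V) ⊗ₖ (1 : Op W)) = pauliX (Sum.inl u) := by
  ext x y
  simp only [joinRegisters, Matrix.submatrix_apply, Matrix.kroneckerMap_apply, pauliX, Matrix.of_apply,
    Matrix.one_apply, mul_ite, mul_one, mul_zero, ← ite_and]
  congr 1
  simp only [eq_iff_iff, Equiv.sumArrowEquivProdArrow, Equiv.coe_fn_mk, Function.comp_def]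
  constructor
  · rintro ⟨h1, h2⟩
    ext (i | j)
    · have := congrFun h2 i
      by_cases hi : i = u
      · subst hi; simpa using this
      · simpa [hi] using this
    · have := congrFun h1 j
      simpa using this.symm
  · rintro rfl
    refine ⟨by ext j; simp, ?_⟩
    ext i
    by_cases hi : i = u
    · subst hi; simp
    · simp [hi]

lemma joinRegisters_one_kronecker_pauliX (u : W) :
    joinRegisters ((1 : Op V) ⊗ₖ (pauliX u : Op W)) = pauliX (Sum.inr u) := by
  ext x y
  simp only [joinRegisters, Matrix.submatrix_apply, Matrix.kroneckerMap_apply, pauliX, Matrix.of_apply,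
    Matrix.one_apply, mul_ite, mul_one, mul_zero, ← ite_and]
  congr 1
  simp only [eq_iff_iff, Equiv.sumArrowEquivProdArrow, Equiv.coe_fn_mk, Function.comp_def]
  constructor
  · rintro ⟨h1, h2⟩
    ext (i | j)
    · have := congrFun h2 i
      simpa using this.symm
    · have := congrFun h1 j
      by_cases hj : j = u
      · subst hj; simpa using this
      · simpa [hj] using this
  · rintro rfl
    refine ⟨?_, by ext j; simp⟩
    ext i
    by_cases hi : i = u
    · subst hi; simp
    · simp [hi]

lemma joinRegisters_one_kronecker_pauliZ (u : W) :
    joinRegisters ((1 : Op V) ⊗ₖ (pauliZ u : Op W)) = pauliZ (Sum.inr u) := by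
  rw [pauliZ_eq, joinRegisters_one_kronecker_diagonal, pauliZ_eq]

lemma joinRegisters_one_kronecker_pauliZ_mul (u v : W) :
    joinRegisters ((1 : Op V) ⊗ₖ (pauliZ u * pauliZ v : Op W))
      = pauliZ (Sum.inr u) * pauliZ (Sum.inr v) := by
  rw [pauliZ_eq, pauliZ_eq, Matrix.diagonal_mul_diagonal, joinRegisters_one_kronecker_diagonal,
    pauliZ_eq, pauliZ_eq, Matrix.diagonal_mul_diagonal]

/-- Joining the registers is real-linear. -/
def joinRegistersLinear : Matrix (Bits V × Bits W) (Bits V × Bits W) ℂ →ₗ[ℝ] Op (V ⊕ W) where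
  toFun := joinRegisters
  map_add' _ _ := rfl
  map_smul' _ _ := rfl

/-- The map `C ↦ I ⊗ C` into the joint register. -/
def onSecond : Op W →ₗ[ℝ] Op (V ⊕ W) where
  toFun C := joinRegisters ((1 : Op V) ⊗ₖ C)
  map_add' A B := by rw [Matrix.kronecker_add]; rfl
  map_smul' r A := by rw [Matrix.kronecker_smul]; rfl

lemma isTFI_onSecond_pauliZ (u : W) : IsTFI (onSecond (V := V) (pauliZ u)) := by
  rw [onSecond, LinearMap.coe_mk, AddHom.coe_mk, joinRegisters_one_kronecker_pauliZ]
  exact isTFI_pauliZ _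

lemma isTFI_onSecond_pauliX (u : W) : IsTFI (onSecond (V := V) (pauliX u)) := by
  rw [onSecond, LinearMap.coe_mk, AddHom.coe_mk, joinRegisters_one_kronecker_pauliX]
  exact isTFI_pauliX _

lemma isTFI_onSecond_one : IsTFI (onSecond (V := V) (1 : Op W)) := by
  rw [onSecond, LinearMap.coe_mk, AddHom.coe_mk, Matrix.one_kronecker_one, joinRegisters_one]
  exact isTFI_one

lemma isTFI_onSecond_pauliZ_mul {u v : W} (h : v ≠ u) :
    IsTFI (onSecond (V := V) (pauliZ u * pauliZ v)) := by
  rw [onSecond, LinearMap.coe_mk, AddHom.coe_mk, joinRegisters_one_kronecker_pauliZ_mul]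
  exact isTFI_pauliZ_mul_pauliZ (by simpa using h)

lemma isTFI_onSecond_QL (ℓ : ℕ) [NeZero ℓ] (ΔL : ℝ) : IsTFI (onSecond (V := V) (QL ℓ ΔL)) := by
  simp only [QL, map_smul, map_sub, map_add, map_sum]
  refine IsTFI.smul _ (((isTFI_onSecond_one.smul _).add (isTFI_onSecond_pauliZ _)).sub
    (isTFI_onSecond_pauliZ _) |>.sub (isTFI_sum _ fun i => isTFI_onSecond_pauliZ_mul ?_))
  simp

lemma isTFI_onSecond_XL (ℓ : ℕ) : IsTFI (onSecond (V := V) (XL ℓ)) := by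
  simp only [XL, map_neg, map_sum]
  exact (isTFI_sum _ fun i => isTFI_onSecond_pauliX i).neg

lemma isTFI_onSecond_ZL (ℓ : ℕ) (ε t : ℝ) : IsTFI (onSecond (V := V) (ZL ℓ ε t)) := by
  simp only [ZL, map_smul, map_sum, map_sub]
  exact (isTFI_sum _ fun i => (isTFI_onSecond_one.sub (isTFI_onSecond_pauliZ i)).smul _).smul _

lemma isTFI_joinRegisters_XB (nB ℓ : ℕ) (ΔB : ℝ) :
    IsTFI (joinRegisters (XB nB ΔB ⊗ₖ (1 : Op (Fin ℓ)))) := by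
  rw [XB_kronecker_one]
  change IsTFI (joinRegistersLinear _)
  rw [map_neg, map_smul, map_sum]
  refine ((isTFI_sum _ fun i => ?_).smul _).neg
  change IsTFI (joinRegisters _)
  rw [joinRegisters_pauliX_kronecker_one]
  exact isTFI_pauliX _

end TransverseFieldIsing

/-! ### Affine dependence on time, clock blocks, and points of the paths -/

section Structure

variable {nB ℓ : ℕ}

lemma DC_isDiag {D : Fin (ℓ + 1) → Op (Fin nB)} (hD : ∀ i, (D i).IsDiag) : (DC D).IsDiag := by
  intro x y hxy
  rw [DC, Matrix.sum_apply]
  refine Finset.sum_eq_zero fun i _ => ?_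
  refine Matrix.IsDiag.kronecker (hD i) ?_ hxy
  rw [← Matrix.diagonal_single]
  exact Matrix.isDiag_diagonal _

lemma DC_apply_clock (D : Fin (ℓ + 1) → Op (Fin nB)) (x y : Bits (Fin nB)) (j : Fin (ℓ + 1)) :
    DC D (x, clock ℓ j) (y, clock ℓ j) = D j x y := by
  rw [DC, Matrix.sum_apply, Finset.sum_eq_single j]
  · simp
  · intro i _ hi
    have : clock ℓ i ≠ clock ℓ j := fun h => hi (clock_injective ℓ h)
    simp [this]
  · simp

lemma ZL_convex (ε a b r : ℝ) :
    ZL ℓ ε ((1 - r) * a + r * b) = (1 - r) • ZL ℓ ε a + r • ZL ℓ ε b := by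
  simp only [ZL, Finset.smul_sum, ← Finset.sum_add_distrib]
  refine Finset.sum_congr rfl fun i _ => ?_
  module

variable [NeZero ℓ]

/-- At the time where `D_C` is switched off, `H_C'` is a transverse field Ising Hamiltonian. -/
lemma isTFI_HC' (ΔB : ℝ) (D : Fin (ℓ + 1) → Op (Fin nB)) (ε ΔL ΔC : ℝ) {η t : ℝ}
    (h : 1 + t * η = 0) : IsTFI (joinRegisters (HC' ΔB D ε ΔL ΔC η t)) := by
  rw [HC', h, zero_smul, add_zero]
  change IsTFI (joinRegistersLinear _)
  rw [map_add, map_smul, map_smul]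
  refine IsTFI.add (IsTFI.smul _ ?_) (IsTFI.smul _ (isTFI_joinRegisters_XB nB ℓ ΔB))
  change IsTFI (onSecond _)
  rw [map_add, map_add, map_smul]
  exact ((isTFI_onSecond_QL ℓ ΔL).add ((isTFI_onSecond_XL ℓ).smul _)).add (isTFI_onSecond_ZL ℓ ε t)

lemma isDiag_HC' (ΔB : ℝ) {D : Fin (ℓ + 1) → Op (Fin nB)} (hD : ∀ i, (D i).IsDiag)
    (ε ΔL ΔC : ℝ) {η t : ℝ} (h : 1 - t * η = 0) : (HC' ΔB D ε ΔL ΔC η t).IsDiag := by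
  rw [HC', h, zero_smul, zero_smul, add_zero, add_zero, QL_add_ZL]
  refine Matrix.IsDiag.add (Matrix.IsDiag.smul _ (Matrix.IsDiag.kronecker Matrix.isDiag_one
    (Matrix.isDiag_diagonal _))) (Matrix.IsDiag.smul _ (DC_isDiag hD))

lemma submatrix_HC' (ΔB : ℝ) (D : Fin (ℓ + 1) → Op (Fin nB)) (ε ΔL ΔC η t : ℝ) (j : Fin (ℓ + 1)) :
    (HC' ΔB D ε ΔL ΔC η t).submatrix (fun x => (x, clock ℓ j)) (fun x => (x, clock ℓ j))
      = (ΔC * ((j : ℕ) * ((j : ℕ) + 1 - 2 * t)) / ε) • (1 : Op (Fin nB))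
        + (1 - t * η) • XB nB ΔB + (1 + t * η) • D j := by
  ext x y
  have hC : (QL ℓ ΔL + (1 - t * η) • XL ℓ + ZL ℓ ε t) (clock ℓ j) (clock ℓ j)
      = (((j : ℕ) * ((j : ℕ) + 1 - 2 * t) / ε : ℝ) : ℂ) := by
    rw [add_right_comm, QL_add_ZL]
    simp only [Matrix.add_apply, Matrix.diagonal_apply_eq, Matrix.smul_apply, XL_apply_self,
      smul_zero, add_zero, clockPotential_clock]
  simp only [HC', Matrix.submatrix_apply, Matrix.add_apply, Matrix.smul_apply, DC_apply_clock]
  rw [Matrix.kronecker_apply, Matrix.kronecker_apply, hC]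
  simp only [Matrix.one_apply_eq, mul_one]
  congr 2
  by_cases h : x = y
  · subst h
    simp
    ring
  · simp [h]

lemma HC'_convex (ΔB : ℝ) (D : Fin (ℓ + 1) → Op (Fin nB)) (ε ΔL ΔC η a b r : ℝ) :
    (1 - r) • HC' ΔB D ε ΔL ΔC η a + r • HC' ΔB D ε ΔL ΔC η b
      = HC' ΔB D ε ΔL ΔC η ((1 - r) * a + r * b) := by
  simp only [HC', ZL_convex, Matrix.kronecker_add, Matrix.kronecker_smul]
  module

lemma tiltedPath_eq (ΔB : ℝ) (D : Fin (ℓ + 1) → Op (Fin nB)) (ε ΔL ΔC : ℝ) {η : ℝ} (hη : 0 < η)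
    {s : ℝ} (hs : s ∈ Set.Icc (0 : ℝ) 1) :
    ∃ t, |t| ≤ 1 / η ∧ tiltedPath ΔB D ε ΔL ΔC η s = HC' ΔB D ε ΔL ΔC η t := by
  rcases eq_or_lt_of_le hs.2 with rfl | h1
  -- At `s = 1` the floor jumps to 1 and the fractional part to 0, so the last node appears as the
  -- first summand.
  · refine ⟨1 / η, by rw [abs_of_pos (by positivity)], ?_⟩
    simp [tiltedPath, piecewiseLinear, Fin.clamp]
  · refine ⟨(1 - s) * (-1 / η) + s * (1 / η), ?_, ?_⟩
    · rw [show (1 - s) * (-1 / η) + s * (1 / η) = (2 * s - 1) / η by ring, abs_div, abs_of_pos hη]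
      gcongr
      rw [abs_le]; constructor <;> linarith [hs.1]
    · have hf : ⌊s⌋₊ = 0 := Nat.floor_eq_zero.mpr h1
      have hr : Int.fract s = s := Int.fract_eq_self.mpr ⟨hs.1, h1⟩
      rw [← HC'_convex]
      simp [tiltedPath, piecewiseLinear, Fin.clamp, hf, hr]

lemma exists_piecewiseLinear_eq {E : Type} [AddCommGroup E] [Module ℝ E] (H : Fin (ℓ + 1) → E)
    (k : Fin ℓ) {θ : ℝ} (h0 : 0 ≤ θ) (h1 : θ ≤ 1) :
    ∃ s ∈ Set.Icc (0 : ℝ) 1,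
      piecewiseLinear H s = (1 - θ) • H k.castSucc + θ • H k.succ := by
  have hℓ : (0 : ℝ) < ℓ := by exact_mod_cast Nat.pos_of_ne_zero (NeZero.ne ℓ)
  have hk : ((k : ℕ) : ℝ) + 1 ≤ ℓ := by exact_mod_cast k.2
  refine ⟨((k : ℕ) + θ) / ℓ, ⟨by positivity, by rw [div_le_one hℓ]; linarith⟩, ?_⟩
  rw [piecewiseLinear, mul_div_cancel₀ _ hℓ.ne']
  rcases eq_or_lt_of_le h1 with rfl | h1
  · have hf : ⌊((k : ℕ) : ℝ) + 1⌋₊ = (k : ℕ) + 1 := by exact_mod_cast Nat.floor_natCast ((k : ℕ) + 1)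
    have hr : Int.fract (((k : ℕ) : ℝ) + 1) = 0 := by exact_mod_cast Int.fract_natCast ((k : ℕ) + 1)
    have hc : Fin.clamp ((k : ℕ) + 1) ℓ = k.succ := Fin.ext (by simp [Fin.clamp])
    rw [hf, hr, hc]; simp
  · have hf : ⌊((k : ℕ) : ℝ) + θ⌋₊ = (k : ℕ) := by
      rw [Nat.floor_eq_iff (by positivity)]; constructor <;> linarith
    have hr : Int.fract (((k : ℕ) : ℝ) + θ) = θ := by
      rw [Int.fract_natCast_add]; exact Int.fract_eq_self.mpr ⟨h0, h1⟩
    have hc : Fin.clamp (k : ℕ) ℓ = k.castSucc := Fin.ext (by simp [Fin.clamp])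
    have hc' : Fin.clamp ((k : ℕ) + 1) ℓ = k.succ := Fin.ext (by simp [Fin.clamp])
    rw [hf, hr, hc, hc']

end Structure

/-! ### From the gap of the piecewise linear path to the gap of the tilted path -/

section GapComparison

variable {nB ℓ : ℕ}

lemma mul_le_spectralGap_smul {ι : Type} [Fintype ι] [DecidableEq ι] {H : Matrix ι ι ℂ}
    (hH : H.IsHermitian) (hc : 2 ≤ Fintype.card ι) {a δ : ℝ} (ha : 0 ≤ a)
    (h : δ ≤ spectralGap H) : a * δ ≤ spectralGap (a • H) := by
  obtain ⟨g, hg, hmin⟩ := exists_ground hH hc h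
  refine le_spectralGap (isHermitian_real_smul hH a) hc g hg le_rfl fun x hx => ?_
  have := mul_le_mul_of_nonneg_left (hmin x) ha
  rw [hx, norm_zero] at this
  rw [energy_smul, energy_smul]
  nlinarith

/-- In units of `ΔB * nB`, the basis state at `u` has energy `-3b`, while orthogonally to it only
the field acts, with energy at least `-a`. The factor 3 of the well thus leaves a gap `3b - a ≥ 2`.
-/
lemma two_mul_le_spectralGap_final [NeZero nB] {ΔB a b : ℝ} (hΔB : 0 ≤ ΔB) (ha0 : 0 ≤ a)
    (ha1 : a ≤ 1) (hb : 1 ≤ b) {Dℓ : Op (Fin nB)} {u : Bits (Fin nB)}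
    (hDℓ : Dℓ = -((3 * ΔB * nB) • Matrix.single u u (1 : ℂ))) (hD : Dℓ.IsHermitian) :
    2 * (ΔB * nB) ≤ spectralGap (a • XB nB ΔB + b • Dℓ) := by
  have hx0 : 0 ≤ ΔB * nB := by positivity
  refine le_spectralGap (e := -(3 * b * (ΔB * nB)))
    ((isHermitian_real_smul (XB_isHermitian nB ΔB) a).add (isHermitian_real_smul hD b))
    (two_le_card_bits nB) (EuclideanSpace.single u 1) (by simp) ?_ fun x hx => ?_
  · rw [energy_single]
    apply le_of_eq
    simp [XB_apply_self, hDℓ]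
    ring
  · have hxu : x u = 0 := by simpa [EuclideanSpace.inner_single_left] using hx
    have h1 : energy Dℓ x = 0 := by
      have h2 : energy (Matrix.single u u (1 : ℂ)) x = 0 := by
        have h3 : Matrix.single u u (1 : ℂ)
            = Matrix.diagonal fun z => ((Pi.single u 1 : Bits (Fin nB) → ℝ) z : ℂ) := by
          rw [← Matrix.diagonal_single]
          congr 1; ext z
          by_cases hz : z = u
          · subst hz; simp
          · simp [hz]
        rw [h3, energy_diagonal, Finset.sum_eq_single u]
        · simp [hxu]
        · intro z _ hz; simp [hz]
        · simp
      rw [hDℓ, ← neg_smul, energy_smul, h2, mul_zero]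
    rw [energy_add, energy_smul, energy_smul, h1]
    have h4 := (abs_le.mp (abs_energy_le (XB nB ΔB) x)).1
    have h5 : opNorm (XB nB ΔB) * ‖x‖ ^ 2 ≤ ΔB * nB * ‖x‖ ^ 2 := by
      gcongr; exact opNorm_XB_le nB hΔB
    have h6 : 0 ≤ ΔB * nB * ‖x‖ ^ 2 := by positivity
    have h7 : a * -(ΔB * nB * ‖x‖ ^ 2) ≤ a * energy (XB nB ΔB) x :=
      mul_le_mul_of_nonneg_left (by linarith) ha0
    nlinarith

/-- Replacing the weight of the clock state outside `S` by weight on one node changes the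
averaged Hamiltonian by little. -/
lemma opNorm_average_sub_le {D : Fin (ℓ + 1) → Op (Fin nB)} {r w : ℝ} (hr : ∀ j, opNorm (D j) ≤ r)
    (φ : EuclideanSpace ℂ (Bits (Fin ℓ))) (S : Finset (Fin (ℓ + 1))) (k : Fin (ℓ + 1))
    (hw : ∑ z ∈ (S.image (clock ℓ))ᶜ, ‖φ z‖ ^ 2 ≤ w) :
    opNorm (∑ j, ‖φ (clock ℓ j)‖ ^ 2 • D j - (∑ j ∈ S, ‖φ (clock ℓ j)‖ ^ 2 • D j
      + (∑ z ∈ (S.image (clock ℓ))ᶜ, ‖φ z‖ ^ 2) • D k)) ≤ 2 * w * r := by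
  have hr0 : 0 ≤ r := (opNorm_nonneg _).trans (hr 0)
  have h1 : ∑ j, ‖φ (clock ℓ j)‖ ^ 2 • D j - (∑ j ∈ S, ‖φ (clock ℓ j)‖ ^ 2 • D j
      + (∑ z ∈ (S.image (clock ℓ))ᶜ, ‖φ z‖ ^ 2) • D k)
      = ∑ j ∈ Sᶜ, ‖φ (clock ℓ j)‖ ^ 2 • D j
        - (∑ z ∈ (S.image (clock ℓ))ᶜ, ‖φ z‖ ^ 2) • D k := by
    rw [← Finset.sum_add_sum_compl S]; abel
  have h2 : ∑ j ∈ Sᶜ, ‖φ (clock ℓ j)‖ ^ 2 ≤ w := by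
    refine le_trans ?_ hw
    rw [← Finset.sum_image (f := fun z => ‖φ z‖ ^ 2) (g := clock ℓ)
      (fun _ _ _ _ h => clock_injective ℓ h)]
    refine Finset.sum_le_sum_of_subset_of_nonneg ?_ fun _ _ _ => sq_nonneg _
    intro z hz
    obtain ⟨j, hj, rfl⟩ := Finset.mem_image.mp hz
    rw [Finset.mem_compl] at hj ⊢
    intro h
    obtain ⟨i, hi, hij⟩ := Finset.mem_image.mp h
    exact hj (clock_injective ℓ hij ▸ hi)
  have h3 : 0 ≤ ∑ z ∈ (S.image (clock ℓ))ᶜ, ‖φ z‖ ^ 2 :=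
    Finset.sum_nonneg fun _ _ => sq_nonneg _
  rw [h1]
  refine (opNorm_sub_le _ _).trans ?_
  have h4 : opNorm (∑ j ∈ Sᶜ, ‖φ (clock ℓ j)‖ ^ 2 • D j) ≤ w * r := by
    refine (opNorm_sum_le _ _).trans ?_
    calc _ ≤ ∑ j ∈ Sᶜ, ‖φ (clock ℓ j)‖ ^ 2 * r := by
          refine Finset.sum_le_sum fun j _ => ?_
          rw [opNorm_smul, abs_of_nonneg (sq_nonneg _)]
          exact mul_le_mul_of_nonneg_left (hr j) (sq_nonneg _)
      _ ≤ _ := by rw [← Finset.sum_mul]; gcongr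
  have h5 : opNorm ((∑ z ∈ (S.image (clock ℓ))ᶜ, ‖φ z‖ ^ 2) • D k) ≤ w * r := by
    rw [opNorm_smul, abs_of_nonneg h3]
    exact mul_le_mul hw (hr k) (opNorm_nonneg _) (h3.trans hw)
  linarith

lemma opNorm_average_sub_node_le {D : Fin (ℓ + 1) → Op (Fin nB)} {r w : ℝ}
    (hr : ∀ j, opNorm (D j) ≤ r) (φ : EuclideanSpace ℂ (Bits (Fin ℓ))) (hφ : ‖φ‖ = 1)
    (k : Fin (ℓ + 1)) (hw : ∑ z ∈ ({clock ℓ k} : Finset (Bits (Fin ℓ)))ᶜ, ‖φ z‖ ^ 2 ≤ w) :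
    opNorm (∑ j, ‖φ (clock ℓ j)‖ ^ 2 • D j - D k) ≤ 2 * w * r := by
  have h := opNorm_average_sub_le (w := w) hr φ {k} k (by simpa using hw)
  rw [Finset.image_singleton, Finset.sum_singleton, ← add_smul] at h
  have h1 : ‖φ (clock ℓ k)‖ ^ 2 + ∑ z ∈ ({clock ℓ k} : Finset (Bits (Fin ℓ)))ᶜ, ‖φ z‖ ^ 2 = 1 := by
    have := Finset.sum_add_sum_compl ({clock ℓ k} : Finset (Bits (Fin ℓ))) fun z => ‖φ z‖ ^ 2
    rw [Finset.sum_singleton, ← EuclideanSpace.norm_sq_eq, hφ] at this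
    simpa using this
  rwa [h1, one_smul] at h

lemma opNorm_average_sub_edge_le {D : Fin (ℓ + 1) → Op (Fin nB)} {r w : ℝ}
    (hr : ∀ j, opNorm (D j) ≤ r) (φ : EuclideanSpace ℂ (Bits (Fin ℓ))) (hφ : ‖φ‖ = 1)
    (k : Fin ℓ) (hw : ∑ z ∈ ({clock ℓ k.castSucc, clock ℓ k.succ} : Finset (Bits (Fin ℓ)))ᶜ,
      ‖φ z‖ ^ 2 ≤ w) :
    ∃ θ : ℝ, 0 ≤ θ ∧ θ ≤ 1 ∧ opNorm (∑ j, ‖φ (clock ℓ j)‖ ^ 2 • D j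
      - ((1 - θ) • D k.castSucc + θ • D k.succ)) ≤ 2 * w * r := by
  have hk : k.castSucc ≠ k.succ := by intro h; have := congrArg Fin.val h; simp at this
  have himg : ({k.castSucc, k.succ} : Finset (Fin (ℓ + 1))).image (clock ℓ)
      = {clock ℓ k.castSucc, clock ℓ k.succ} := by
    rw [Finset.image_insert, Finset.image_singleton]
  have h := opNorm_average_sub_le (w := w) hr φ {k.castSucc, k.succ} k.castSucc (by rw [himg]; exact hw)
  rw [himg, Finset.sum_pair hk] at h
  have h1 : ‖φ (clock ℓ k.castSucc)‖ ^ 2 + ‖φ (clock ℓ k.succ)‖ ^ 2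
      + ∑ z ∈ ({clock ℓ k.castSucc, clock ℓ k.succ} : Finset (Bits (Fin ℓ)))ᶜ, ‖φ z‖ ^ 2 = 1 := by
    have := Finset.sum_add_sum_compl
      ({clock ℓ k.castSucc, clock ℓ k.succ} : Finset (Bits (Fin ℓ))) fun z => ‖φ z‖ ^ 2
    rw [Finset.sum_pair fun h => hk (clock_injective ℓ h), ← EuclideanSpace.norm_sq_eq, hφ] at this
    simpa using this
  set s := ∑ z ∈ ({clock ℓ k.castSucc, clock ℓ k.succ} : Finset (Bits (Fin ℓ)))ᶜ, ‖φ z‖ ^ 2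
  have hs : 0 ≤ s := Finset.sum_nonneg fun _ _ => sq_nonneg _
  -- The stray weight `s` is assigned to the left node, so that the two coefficients sum to one.
  refine ⟨‖φ (clock ℓ k.succ)‖ ^ 2, sq_nonneg _, by nlinarith [sq_nonneg ‖φ (clock ℓ k.castSucc)‖], ?_⟩
  have h2 : 1 - ‖φ (clock ℓ k.succ)‖ ^ 2 = ‖φ (clock ℓ k.castSucc)‖ ^ 2 + s := by linarith
  rw [h2, add_smul]
  convert h using 2
  abel

/-- The gap of `H_C'(t)` from the gap of the piecewise linear path. -/
lemma le_spectralGap_HC' [NeZero nB] [NeZero ℓ] {ΔB : ℝ} (hΔB : 0 ≤ ΔB)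
    {D : Fin (ℓ + 1) → Op (Fin nB)} {u : Bits (Fin nB)} (hD : ∀ i, (D i).IsHermitian)
    (hD0 : D 0 = 0) (hDℓ : D (Fin.last ℓ) = -((3 * ΔB * nB) • Matrix.single u u (1 : ℂ)))
    {r σ : ℝ} (hr : ∀ j, opNorm (D j) ≤ r) (hσ0 : 0 < σ) (hσ : σ ≤ ΔB * nB)
    (hpath : ∀ (k : Fin ℓ) (θ : ℝ), 0 ≤ θ → θ ≤ 1 →
      σ ≤ spectralGap (XB nB ΔB + ((1 - θ) • D k.castSucc + θ • D k.succ)))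
    {ε ΔL ΔC η t R : ℝ} (hε : 0 < ε) (hΔC : 0 ≤ ΔC) (hη : 0 < η) (ht : |t| ≤ 1 / η)
    (hεℓ : 20 * (ℓ : ℝ) ^ 2 ≤ 1 / ε) (hΔL : (4 * ℓ * (ℓ + 1 / η) + 1) / ε ≤ 4 * ΔL)
    (hηℓ : 2 * (ℓ : ℝ) * η ≤ 1 / 2)
    (hR : opNorm ((1 - t * η) • (XB nB ΔB ⊗ₖ (1 : Op (Fin ℓ))) + (1 + t * η) • DC D) ≤ R)
    (hM : R ^ 2 ≤ (ΔC * (1 / 2) - 2 * R - σ / 8) * (σ / 8))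
    (hκ : 2 * ℓ * η * (ΔB * nB + r) + 4 * (2 * ℓ * ε) * r ≤ σ / 8) :
    σ / 8 ≤ spectralGap (HC' ΔB D ε ΔL ΔC η t) := by
  have hℓ : (1 : ℝ) ≤ ℓ := by exact_mod_cast Nat.one_le_iff_ne_zero.mpr (NeZero.ne ℓ)
  have hr0 : 0 ≤ r := (opNorm_nonneg _).trans (hr 0)
  have htη : |t * η| ≤ 1 := by
    rw [abs_mul, abs_of_pos hη]
    rwa [le_div_iff₀ hη] at ht
  rw [abs_le] at htη
  have hsmall : t ≤ ℓ + 1 / 2 → t * η ≤ 1 / 2 := fun h => by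
    have : t * η ≤ (ℓ + 1 / 2) * η := by gcongr
    nlinarith
  obtain ⟨φ, hφ, hground, hconc⟩ := exists_clock_ground (f := 1 - t * η) hε hεℓ ht hΔL
    (by linarith) (by linarith) (fun h => by linarith [hsmall h])
  have hC : (QL ℓ ΔL + (1 - t * η) • XL ℓ + ZL ℓ ε t).IsHermitian := by
    rw [add_right_comm, QL_add_ZL]
    exact (isHermitian_diagonal_ofReal _).add (isHermitian_real_smul (XL_isHermitian ℓ) _)
  set w := 2 * (ℓ : ℝ) * ε with hw
  have hw0 : 0 ≤ w := by positivity
  have hwr : 0 ≤ w * r := by positivity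
  have hx0 : 0 ≤ ΔB * nB := by positivity
  have hηr : 0 ≤ 2 * ℓ * η * (ΔB * nB + r) := by positivity
  obtain ⟨K, hK, hgap, hdiff⟩ : ∃ K : Op (Fin nB), K.IsHermitian ∧ σ / 2 ≤ spectralGap K ∧
      opNorm (effective ΔB D (1 - t * η) (1 + t * η) (fun j => ‖φ (clock ℓ j)‖ ^ 2) - K)
        ≤ σ / 8 := by
    rcases hconc with ⟨h1, hwt⟩ | ⟨k, h1, h2, hwt⟩ | ⟨h1, hwt⟩
    -- Here `t` may go down to `-1/η`, so the factor of the field is not close to 1; but `D 0 = 0`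
    -- leaves a pure multiple of `XB`, by a factor of at least `1/2`.
    · refine ⟨(1 - t * η) • XB nB ΔB, isHermitian_real_smul (XB_isHermitian nB ΔB) _, ?_, ?_⟩
      · have hX := hpath ⟨0, Nat.pos_of_ne_zero (NeZero.ne ℓ)⟩ 0 le_rfl zero_le_one
        have h0 : (⟨0, Nat.pos_of_ne_zero (NeZero.ne ℓ)⟩ : Fin ℓ).castSucc = 0 := rfl
        rw [h0, hD0, smul_zero, zero_smul, add_zero, add_zero] at hX
        refine le_trans ?_ (mul_le_spectralGap_smul (XB_isHermitian nB ΔB) (two_le_card_bits nB)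
          (by linarith) hX)
        have := hsmall (by linarith)
        nlinarith
      · have h3 := opNorm_average_sub_node_le hr φ hφ 0 hwt
        rw [hD0, sub_zero] at h3
        rw [effective, add_sub_cancel_left, opNorm_smul, abs_of_nonneg (by linarith)]
        have h4 : (1 + t * η) * opNorm (∑ j, ‖φ (clock ℓ j)‖ ^ 2 • D j) ≤ 2 * (2 * w * r) :=
          mul_le_mul (by linarith) h3 (opNorm_nonneg _) (by norm_num)
        linarith
    -- Which edge `k` belongs to `t` is irrelevant, since the gap hypothesis covers all edges. The
    -- errors are the tilt `t * η ≤ 2 * ℓ * η` of both coefficients and the stray weight.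
    · obtain ⟨θ, hθ0, hθ1, h3⟩ := opNorm_average_sub_edge_le hr φ hφ k hwt
      set F := (1 - θ) • D k.castSucc + θ • D k.succ with hF
      have hFh : F.IsHermitian :=
        (isHermitian_real_smul (hD _) _).add (isHermitian_real_smul (hD _) _)
      have hFn : opNorm F ≤ r := by
        refine (opNorm_add_le _ _).trans ?_
        rw [opNorm_smul, opNorm_smul, abs_of_nonneg hθ0, abs_of_nonneg (by linarith)]
        nlinarith [hr k.castSucc, hr k.succ]
      refine ⟨XB nB ΔB + F, (XB_isHermitian nB ΔB).add hFh,
        by linarith [hpath k θ hθ0 hθ1], ?_⟩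
      have h4 : effective ΔB D (1 - t * η) (1 + t * η) (fun j => ‖φ (clock ℓ j)‖ ^ 2)
          - (XB nB ΔB + F) = (-(t * η)) • XB nB ΔB + (t * η) • F
            + (1 + t * η) • (∑ j, ‖φ (clock ℓ j)‖ ^ 2 • D j - F) := by
        rw [effective]; module
      have h5 : t * η ≤ 2 * ℓ * η := by gcongr; linarith
      have h6 : 0 ≤ t * η := by have : 0 ≤ t := by linarith
                                positivity
      rw [h4]
      refine (opNorm_add_le _ _).trans ?_
      have h7 := opNorm_add_le ((-(t * η)) • XB nB ΔB) ((t * η) • F)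
      rw [opNorm_smul, opNorm_smul, abs_neg, abs_of_nonneg h6] at h7
      rw [opNorm_smul, abs_of_nonneg (show 0 ≤ 1 + t * η by linarith)]
      have h8 : (1 + t * η) * opNorm (∑ j, ‖φ (clock ℓ j)‖ ^ 2 • D j - F) ≤ 2 * (2 * w * r) :=
        mul_le_mul (by linarith) h3 (opNorm_nonneg _) (by norm_num)
      have h9 : t * η * opNorm (XB nB ΔB) ≤ 2 * ℓ * η * (ΔB * nB) :=
        mul_le_mul h5 (opNorm_XB_le nB hΔB) (opNorm_nonneg _) (by positivity)
      have h10 : t * η * opNorm F ≤ 2 * ℓ * η * r :=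
        mul_le_mul h5 hFn (opNorm_nonneg _) (by positivity)
      linarith
    · refine ⟨(1 - t * η) • XB nB ΔB + (1 + t * η) • D (Fin.last ℓ),
        (isHermitian_real_smul (XB_isHermitian nB ΔB) _).add (isHermitian_real_smul (hD _) _),
        ?_, ?_⟩
      · have h2 : 0 ≤ t * η := by
          have : 0 ≤ t := by linarith
          positivity
        have := two_mul_le_spectralGap_final hΔB (show 0 ≤ 1 - t * η by linarith) (by linarith)
          (show 1 ≤ 1 + t * η by linarith) hDℓ (hD _)
        linarith
      · have h3 := opNorm_average_sub_node_le hr φ hφ (Fin.last ℓ) hwt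
        rw [effective, add_sub_add_left_eq_sub, ← smul_sub, opNorm_smul,
          abs_of_nonneg (by linarith)]
        have h4 : (1 + t * η) * opNorm (∑ j, ‖φ (clock ℓ j)‖ ^ 2 • D j - D (Fin.last ℓ))
            ≤ 2 * (2 * w * r) :=
          mul_le_mul (by linarith) h3 (opNorm_nonneg _) (by norm_num)
        linarith
  -- The gap `σ / 2` of `K` is spent as `σ / 4` plus twice the error `σ / 8`; freezing the clock
  -- halves the `σ / 4`.
  have h1 : σ / 8 = σ / 4 / 2 := by ring
  rw [HC', add_assoc, h1]
  refine half_le_spectralGap_of_near hD hC hΔC (by linarith) hR ?_ φ hφ hground hK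
    (κ := σ / 8) (by linarith) hdiff
  rw [← h1]; exact hM

end GapComparison

/-! ### Operator norms and the nodes of the base path -/

section Norms

variable {nB ℓ : ℕ}

lemma DC_eq_diagonal {D : Fin (ℓ + 1) → Op (Fin nB)} (hD : ∀ i, (D i).IsDiag) :
    DC D = Matrix.diagonal fun p => DC D p p := by
  ext x y
  by_cases hxy : x = y
  · subst hxy; simp
  · rw [DC_isDiag hD hxy, Matrix.diagonal_apply_ne _ hxy]

/-- Each diagonal entry meets at most one `D j`, so the bound does not grow with the number of
nodes. -/
lemma opNorm_DC_le {D : Fin (ℓ + 1) → Op (Fin nB)} (hD : ∀ i, (D i).IsDiag) {r : ℝ}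
    (hr : ∀ j, opNorm (D j) ≤ r) : opNorm (DC D) ≤ r := by
  have hr0 : 0 ≤ r := (opNorm_nonneg _).trans (hr 0)
  rw [DC_eq_diagonal hD]
  refine opNorm_diagonal_le _ hr0 fun ⟨x, z⟩ => ?_
  by_cases hz : ∃ j, z = clock ℓ j
  · obtain ⟨j, rfl⟩ := hz
    rw [DC_apply_clock]
    exact (norm_apply_le_opNorm _ _).trans (hr j)
  · push Not at hz
    rw [DC, Matrix.sum_apply, Finset.sum_eq_zero fun i _ => ?_]
    · simpa using hr0
    · have : clock ℓ i ≠ z := (hz i).symm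
      simp [this]

variable [NeZero ℓ]

lemma opNorm_HC'_le {ΔB : ℝ} {D : Fin (ℓ + 1) → Op (Fin nB)}
    {ε ΔL ΔC η t R : ℝ} (hε : 0 < ε) (hΔC : 0 ≤ ΔC) (hΔL : 0 ≤ ΔL) (hη : 0 < η)
    (ht : |t| ≤ 1 / η)
    (hR : opNorm ((1 - t * η) • (XB nB ΔB ⊗ₖ (1 : Op (Fin ℓ))) + (1 + t * η) • DC D) ≤ R) :
    opNorm (HC' ΔB D ε ΔL ΔC η t)
      ≤ ΔC * (ΔL * (4 * ℓ) + 2 * ℓ * (ℓ + 1 / η) / ε + 2 * ℓ) + R := by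
  have htη : |t * η| ≤ 1 := by
    rw [abs_mul, abs_of_pos hη]
    rwa [le_div_iff₀ hη] at ht
  have hf : |1 - t * η| ≤ 2 := by
    rw [abs_le] at htη ⊢; constructor <;> linarith
  rw [HC', add_assoc]
  refine (opNorm_add_le _ _).trans (add_le_add ?_ hR)
  rw [opNorm_smul, abs_of_nonneg hΔC, add_right_comm, QL_add_ZL, Matrix.kronecker_add,
    Matrix.kronecker_smul]
  refine mul_le_mul_of_nonneg_left ((opNorm_add_le _ _).trans (add_le_add ?_ ?_)) hΔC
  · rw [← Matrix.diagonal_one, Matrix.diagonal_kronecker_diagonal]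
    refine opNorm_diagonal_le _ (by positivity) fun p => ?_
    rw [one_mul, Complex.norm_real, Real.norm_eq_abs, clockPotential]
    refine (abs_add_le _ _).trans (add_le_add ?_ ?_)
    · rw [abs_of_nonneg (mul_nonneg hΔL (wallPotential_nonneg ℓ _))]
      exact mul_le_mul_of_nonneg_left (wallPotential_le ℓ _) hΔL
    · rw [abs_div, abs_of_pos hε]
      gcongr
      exact abs_tiltPotential_le ℓ ht _
  · rw [opNorm_smul]
    exact mul_le_mul hf (opNorm_one_kronecker_XL_le nB ℓ) (opNorm_nonneg _) (by norm_num)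

end Norms

section PathNodes

lemma opNorm_weighted_add_le {ι : Type} [Fintype ι] [DecidableEq ι] {A B : Matrix ι ι ℂ}
    {s a b : ℝ} (hs : |s| ≤ 1) (hA : opNorm A ≤ a) (hB : opNorm B ≤ b) :
    opNorm ((1 - s) • A + (1 + s) • B) ≤ 2 * a + 2 * b := by
  rw [abs_le] at hs
  refine (opNorm_add_le _ _).trans (add_le_add ?_ ?_) <;>
    rw [opNorm_smul, abs_of_nonneg (by linarith)]
  · exact mul_le_mul (by linarith) hA (opNorm_nonneg _) (by norm_num)
  · exact mul_le_mul (by linarith) hB (opNorm_nonneg _) (by norm_num)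

variable {nB ℓ : ℕ} [NeZero ℓ] {ΔB : ℝ} {D : Fin (ℓ + 1) → Op (Fin nB)}

lemma basePath_node_norm_le {B : ℝ} (h : PathNormLE (basePath ΔB D) B) (j : Fin (ℓ + 1)) :
    opNorm (XB nB ΔB + D j) ≤ B := by
  rcases Fin.eq_zero_or_eq_succ j with rfl | ⟨k, rfl⟩
  · obtain ⟨s, hs, hs'⟩ := exists_piecewiseLinear_eq (fun i => XB nB ΔB + D i) 0 le_rfl zero_le_one
    have := h s hs
    rw [basePath, hs'] at this
    simpa using this
  · obtain ⟨s, hs, hs'⟩ := exists_piecewiseLinear_eq (fun i => XB nB ΔB + D i) k zero_le_one le_rfl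
    have := h s hs
    rw [basePath, hs'] at this
    simpa using this

lemma basePath_edge_gap_ge {δ : ℝ} (h : PathGapGE (basePath ΔB D) δ) (k : Fin ℓ) {θ : ℝ}
    (h0 : 0 ≤ θ) (h1 : θ ≤ 1) :
    δ ≤ spectralGap (XB nB ΔB + ((1 - θ) • D k.castSucc + θ • D k.succ)) := by
  obtain ⟨s, hs, hs'⟩ := exists_piecewiseLinear_eq (fun i => XB nB ΔB + D i) k h0 h1
  have h2 := h s hs
  rw [basePath, hs'] at h2
  have h3 : (1 - θ) • (XB nB ΔB + D k.castSucc) + θ • (XB nB ΔB + D k.succ)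
      = XB nB ΔB + ((1 - θ) • D k.castSucc + θ • D k.succ) := by module
  rwa [h3] at h2

end PathNodes

/-! ### Polynomial inequalities for the parameters -/

section Parameters

variable {p q σ l : ℝ}

lemma clock_energy_dominates (hp : 1 ≤ p) (hqp : 100 * p ≤ q) (hσ0 : 0 < σ) (hσp : σ ≤ p)
    (hqσ : 100 * p ≤ q * σ) :
    (6 * p ^ 2) ^ 2 ≤ (q ^ 6 * (1 / 2) - 2 * (6 * p ^ 2) - σ / 8) * (σ / 8) := by
  have hp0 : 0 < p := by linarith
  have hq0 : 0 < q := by linarith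
  have h1 : q ^ 5 ≤ q ^ 6 * (1 / 2) - 2 * (6 * p ^ 2) - σ / 8 := by
    have h2 : 100 * q ^ 5 ≤ q ^ 6 := by
      rw [pow_succ' q 5]; gcongr; linarith
    have h3 : q ^ 2 ≤ q ^ 5 := pow_le_pow_right₀ (by linarith) (by norm_num)
    have h4 : (100 * p) ^ 2 ≤ q ^ 2 := by gcongr
    have h5 : p ≤ p ^ 2 := by nlinarith
    linarith
  have h6 : (100 * p) ^ 4 ≤ q ^ 4 := by gcongr
  calc (6 * p ^ 2) ^ 2 = 36 * p ^ 4 := by ring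
    _ ≤ q ^ 4 := by linarith [pow_pos hp0 4]
    _ ≤ q ^ 4 * (100 * p / 8) := le_mul_of_one_le_right (by positivity) (by linarith)
    _ ≤ q ^ 4 * (q * σ / 8) := by gcongr
    _ = q ^ 5 * (σ / 8) := by ring
    _ ≤ _ := by gcongr

lemma effective_error_le {x : ℝ} (hp : 1 ≤ p) (hqp : 100 * p ≤ q) (hl : 0 ≤ l) (hlp : l ≤ p)
    (hx : x ≤ p ^ 2) (hqσ : 100 * p ≤ q * σ) :
    2 * l * (1 / q ^ 4) * (x + 2 * p ^ 2) + 4 * (2 * l * (1 / q ^ 4)) * (2 * p ^ 2) ≤ σ / 8 := by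
  have hp0 : 0 < p := by linarith
  have hq0 : 0 < q := by linarith
  have h1 : 2 * l * (1 / q ^ 4) * (x + 2 * p ^ 2) + 4 * (2 * l * (1 / q ^ 4)) * (2 * p ^ 2)
      = l * (2 * x + 20 * p ^ 2) / q ^ 4 := by ring
  rw [h1, div_le_iff₀ (by positivity)]
  calc l * (2 * x + 20 * p ^ 2) ≤ l * (22 * p ^ 2) :=
        mul_le_mul_of_nonneg_left (by linarith) hl
    _ ≤ p * (22 * p ^ 2) := by gcongr
    _ = 22 * p ^ 3 * 1 := by ring
    _ ≤ 22 * p ^ 3 * (5000 * p) := by gcongr; linarith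
    _ ≤ (100 * p) ^ 3 * (100 * p) / 8 := by linarith [pow_pos hp0 4]
    _ ≤ q ^ 3 * (q * σ) / 8 := by gcongr
    _ = σ / 8 * q ^ 4 := by ring

lemma wall_penalty_dominates (hl : 0 ≤ l) (hlq : 4 * l ≤ q) (hq : 1 ≤ q) :
    (4 * l * (l + 1 / (1 / q ^ 4)) + 1) / (1 / q ^ 4) ≤ 4 * q ^ 10 := by
  have h3 : q ≤ q ^ 4 := by simpa using pow_le_pow_right₀ hq (show 1 ≤ 4 by norm_num)
  have h4 : 4 * l * (l + q ^ 4) ≤ q * (2 * q ^ 4) := by gcongr; linarith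
  have h5 : q ^ 5 ≤ q ^ 6 := pow_le_pow_right₀ hq (by norm_num)
  have h6 : 1 ≤ q ^ 6 := one_le_pow₀ hq
  rw [div_div_eq_mul_div, div_one, one_div_one_div]
  calc (4 * l * (l + q ^ 4) + 1) * q ^ 4 ≤ 4 * q ^ 6 * q ^ 4 := by gcongr; linarith
    _ = 4 * q ^ 10 := by ring

lemma total_norm_le (hp : 1 ≤ p) (hqp : 100 * p ≤ q) (hl : 0 ≤ l) (hlp : l ≤ p) :
    q ^ 6 * (q ^ 10 * (4 * l) + 2 * l * (l + 1 / (1 / q ^ 4)) / (1 / q ^ 4) + 2 * l) + 6 * p ^ 2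
      ≤ q ^ 20 := by
  have hq : 1 ≤ q := by linarith
  have hpow : ∀ i j : ℕ, i ≤ j → q ^ i ≤ q ^ j := fun i j h => pow_le_pow_right₀ hq h
  rw [div_div_eq_mul_div, div_one, one_div_one_div]
  have h2 : 4 * l ≤ q := by linarith
  have h3 : q ≤ q ^ 4 := by simpa using hpow 1 4 (by norm_num)
  have h4 : 2 * l * (l + q ^ 4) * q ^ 4 ≤ q * (2 * q ^ 4) * q ^ 4 := by
    gcongr <;> linarith
  have h6 : q ^ 10 * (4 * l) ≤ q ^ 10 * q := by gcongr
  have h8 := hpow 9 11 (by norm_num)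
  have h9 := hpow 1 11 (by norm_num)
  have h10 : q ^ 10 * (4 * l) + 2 * l * (l + q ^ 4) * q ^ 4 + 2 * l ≤ 4 * q ^ 11 := by linarith
  have h11 : (100 * p) ^ 2 ≤ q ^ 2 := by gcongr
  calc q ^ 6 * (q ^ 10 * (4 * l) + 2 * l * (l + q ^ 4) * q ^ 4 + 2 * l) + 6 * p ^ 2
      ≤ q ^ 6 * (4 * q ^ 11) + q ^ 17 := by
        gcongr
        linarith [hpow 2 17 (by norm_num), sq_nonneg p]
    _ = 5 * q ^ 17 := by ring
    _ ≤ q * q ^ 17 := by gcongr; linarith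
    _ = q ^ 18 := by ring
    _ ≤ q ^ 20 := hpow _ _ (by norm_num)

end Parameters

end TiltedPath

end

/-! ### Choice of the parameters and conclusion -/

/-- `P` and `Q` are the polynomials behind the `poly` bounds of the hypotheses and of the
conclusion, `c` and `c'` the constants behind the bounds `Ω(√m)`. The parameters are chosen before
the diagonal Hamiltonians `D i` and the bit string `u`. -/
theorem lemma4p9 :
    ∀ c : ℝ, 0 < c → ∃ c' : ℝ, 0 < c' ∧ ∀ P : Polynomial ℕ, ∃ Q : Polynomial ℕ,
      ∀ (N : ℕ) (m ΔB : ℝ) (nB ℓ : ℕ) [NeZero nB] [NeZero ℓ], 1 ≤ N → 1 ≤ m → m ≤ ΔB →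
        ΔB ≤ (P.eval N : ℕ) → nB ≤ P.eval N → ℓ ≤ P.eval N →
        ∃ εL ΔL ΔC η : ℝ,
          1 / ((Q.eval N : ℕ) : ℝ) ≤ εL ∧ εL ≤ 1 ∧
          0 < ΔL ∧ ΔL ≤ (Q.eval N : ℕ) ∧
          ΔC ≤ (Q.eval N : ℕ) ∧
          1 / ((Q.eval N : ℕ) : ℝ) ≤ η ∧
          ∀ (D : Fin (ℓ + 1) → Op (Fin nB)) (u : Bits (Fin nB)),
            (∀ i, (D i).IsDiag ∧ (D i).IsHermitian) →
            D 0 = 0 →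
            D (Fin.last ℓ) = -((3 * ΔB * nB) • Matrix.single u u (1 : ℂ)) →
            PathGapGE (basePath ΔB D) (c * √m) →
            PathNormLE (basePath ΔB D) (P.eval N : ℕ) →
              10 * opNorm (DC D) ≤ ΔC ∧
              η ≤ 1 / (10 * opNorm (DC D) + ℓ) ∧
              -- the start is a transverse field Ising Hamiltonian, the end is diagonal
              IsTFI (joinRegisters (HC' ΔB D εL ΔL ΔC η (-1 / η))) ∧
              (HC' ΔB D εL ΔL ΔC η (1 / η)).IsDiag ∧
              -- the diagonal block of each clock state carries the corresponding node
              (∀ (t : ℝ) (j : Fin (ℓ + 1)),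
                (HC' ΔB D εL ΔL ΔC η t).submatrix (fun x => (x, clock ℓ j)) (fun x => (x, clock ℓ j))
                  = (ΔC * ((j : ℕ) * ((j : ℕ) + 1 - 2 * t)) / εL) • (1 : Op (Fin nB))
                    + (1 - t * η) • XB nB ΔB + (1 + t * η) • D j) ∧
              PathGapGE (tiltedPath ΔB D εL ΔL ΔC η) (c' * √m) ∧
              PathNormLE (tiltedPath ΔB D εL ΔL ΔC η) (Q.eval N : ℕ) := by
  intro c hc
  -- Capping `c` at 1 gives `σ ≤ √m ≤ m ≤ ΔB * nB`, so the target gap does not exceed the field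
  -- scale that governs the end of the path.
  obtain ⟨c₀, hc₀⟩ : ∃ c₀ : ℝ, c₀ = min c 1 := ⟨_, rfl⟩
  have hc₀0 : 0 < c₀ := hc₀ ▸ lt_min hc one_pos
  have hc₀1 : c₀ ≤ 1 := hc₀ ▸ min_le_right _ _
  have hc₀c : c₀ ≤ c := hc₀ ▸ min_le_left _ _
  refine ⟨c₀ / 8, by positivity, fun P => ?_⟩
  -- A natural number, because `Q` has natural coefficients. It makes `q = 100 * A * p` large also
  -- relative to the gap: `q * σ ≥ 100 * p`.
  obtain ⟨A, hA⟩ := exists_nat_ge (1 / c₀)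
  have hA1 : (1 : ℝ) ≤ A := le_trans (by rw [le_div_iff₀ hc₀0]; linarith) hA
  have hcA : 1 ≤ c₀ * A := by rwa [div_le_iff₀' hc₀0] at hA
  refine ⟨(Polynomial.C (100 * A) * P) ^ 20, ?_⟩
  intro N m ΔB nB ℓ _ _ hN hm hmB hBP hnP hℓP
  obtain ⟨p, hp⟩ : ∃ p : ℝ, p = ((P.eval N : ℕ) : ℝ) := ⟨_, rfl⟩
  have hnB : (1 : ℝ) ≤ nB := by exact_mod_cast Nat.one_le_iff_ne_zero.mpr (NeZero.ne nB)
  have hℓ : (1 : ℝ) ≤ ℓ := by exact_mod_cast Nat.one_le_iff_ne_zero.mpr (NeZero.ne ℓ)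
  rw [← hp] at hBP
  have hnp : (nB : ℝ) ≤ p := by rw [hp]; exact_mod_cast hnP
  have hℓp : (ℓ : ℝ) ≤ p := by rw [hp]; exact_mod_cast hℓP
  have hp1 : 1 ≤ p := by linarith
  have hB0 : 0 ≤ ΔB := by linarith
  obtain ⟨q, hq⟩ : ∃ q : ℝ, q = 100 * A * p := ⟨_, rfl⟩
  have hQ : ((((Polynomial.C (100 * A) * P) ^ 20).eval N : ℕ) : ℝ) = q ^ 20 := by
    simp [hq, hp]
  rw [hQ]
  have hqp : 100 * p ≤ q := by rw [hq]; nlinarith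
  have hq100 : 100 ≤ q := by linarith
  have hq0 : 0 < q := by linarith
  have hq1 : 1 ≤ q := by linarith
  have hX : ΔB * nB ≤ p ^ 2 := by rw [sq]; gcongr
  have hX0 : 1 ≤ ΔB * nB := by nlinarith
  have hsqrt1 : 1 ≤ √m := Real.one_le_sqrt.mpr hm
  have hsqrtm : √m ≤ m := by
    rw [Real.sqrt_le_left (by linarith)]; nlinarith
  obtain ⟨σ, hσ⟩ : ∃ σ : ℝ, σ = c₀ * √m := ⟨_, rfl⟩
  have hσc : c₀ ≤ σ := by rw [hσ]; nlinarith
  have hσ0 : 0 < σ := by linarith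
  have hσm : σ ≤ √m := by
    rw [hσ]; nlinarith
  have hσB : σ ≤ ΔB * nB := by nlinarith
  have hσp : σ ≤ p := by linarith
  have hσA : 1 ≤ σ * A := hcA.trans (by gcongr)
  have hqσ : 100 * p ≤ q * σ := by rw [hq]; nlinarith
  have hpp : p ≤ p ^ 2 := by nlinarith
  have hp2 : (100 * p) ^ 2 ≤ q ^ 2 := pow_le_pow_left₀ (by linarith) hqp 2
  have hq4 : 1 ≤ q ^ 4 := one_le_pow₀ hq1
  have hpow : ∀ k l : ℕ, k ≤ l → q ^ k ≤ q ^ l := fun k l h => pow_le_pow_right₀ hq1 h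
  have hε : (0 : ℝ) < 1 / q ^ 4 := by positivity
  have hinv : 1 / (1 / q ^ 4) = q ^ 4 := one_div_one_div _
  -- With `ε = η = 1 / q ^ 4` the effective error is of order `p ^ 3 / q ^ 4`, below `σ / 8`. The
  -- tilt then reaches order `ℓ * q ^ 8` at `|t| = 1 / η`, which `ΔL = q ^ 10` dominates. `ΔC = q ^
  -- 6` exceeds what freezing needs, of order `p ^ 4 / σ`. The norm is of order `ΔC * ΔL * ℓ`, hence
  -- the power 20 in `Q`.
  refine ⟨1 / q ^ 4, q ^ 10, q ^ 6, 1 / q ^ 4, ?_, ?_, by positivity, hpow _ _ (by norm_num),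
    hpow _ _ (by norm_num), ?_, ?_⟩
  · exact one_div_le_one_div_of_le (by positivity) (hpow _ _ (by norm_num))
  · rw [div_le_one (by positivity)]; exact hq4
  · exact one_div_le_one_div_of_le (by positivity) (hpow _ _ (by norm_num))
  intro D u hD hD0 hDℓ hgap hnorm
  rw [← hp] at hnorm
  -- The parameters precede `D`, so its norm must be bounded through `p` alone: subtract the field
  -- from a node of the path.
  have hr : ∀ j, opNorm (D j) ≤ 2 * p ^ 2 := by
    intro j
    have h1 := opNorm_sub_le (XB nB ΔB + D j) (XB nB ΔB)
    rw [add_sub_cancel_left] at h1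
    have h2 := opNorm_XB_le nB hB0
    linarith [basePath_node_norm_le hnorm j]
  have hDC : opNorm (DC D) ≤ 2 * p ^ 2 := opNorm_DC_le (fun i => (hD i).1) hr
  have hDC0 := opNorm_nonneg (DC D)
  have hpath : ∀ (k : Fin ℓ) (θ : ℝ), 0 ≤ θ → θ ≤ 1 →
      σ ≤ spectralGap (XB nB ΔB + ((1 - θ) • D k.castSucc + θ • D k.succ)) := by
    intro k θ h0 h1
    refine le_trans ?_ (basePath_edge_gap_ge hgap k h0 h1)
    rw [hσ]
    gcongr
  have hR : ∀ t : ℝ, |t| ≤ 1 / (1 / q ^ 4) → opNorm ((1 - t * (1 / q ^ 4)) •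
      (XB nB ΔB ⊗ₖ (1 : Op (Fin ℓ))) + (1 + t * (1 / q ^ 4)) • DC D) ≤ 6 * p ^ 2 := by
    intro t ht
    have htη : |t * (1 / q ^ 4)| ≤ 1 := by
      rw [abs_mul, abs_of_pos hε]
      rwa [le_div_iff₀ hε] at ht
    refine (opNorm_weighted_add_le htη (opNorm_XB_kronecker_one_le nB ℓ hB0) hDC).trans ?_
    linarith
  refine ⟨?_, ?_, isTFI_HC' ΔB D _ _ _ ?_, isDiag_HC' ΔB (fun i => (hD i).1) _ _ _ ?_,
    fun t j => submatrix_HC' ΔB D _ _ _ _ t j, fun s hs => ?_, fun s hs => ?_⟩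
  · have := hpow 2 6 (by norm_num)
    linarith
  · refine one_div_le_one_div_of_le (by linarith) ?_
    have := hpow 2 4 (by norm_num)
    linarith
  · field_simp; norm_num
  · field_simp; norm_num
  · obtain ⟨t, ht, h⟩ := tiltedPath_eq ΔB D (1 / q ^ 4) (q ^ 10) (q ^ 6) hε hs
    rw [h, div_mul_eq_mul_div, ← hσ]
    refine le_spectralGap_HC' hB0 (fun i => (hD i).2) hD0 hDℓ hr hσ0 hσB hpath hε (by positivity)
      hε ht ?_ (wall_penalty_dominates (by linarith) (by linarith) hq1) ?_ (hR t ht)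
      (clock_energy_dominates hp1 hqp hσ0 hσp hqσ)
      (effective_error_le hp1 hqp (by linarith) hℓp hX hqσ)
    · rw [hinv]
      have h1 : (ℓ : ℝ) ^ 2 ≤ p ^ 2 := by gcongr
      have := hpow 2 4 (by norm_num)
      linarith
    · rw [mul_one_div, div_le_iff₀ (by positivity)]
      have := hpow 1 4 (by norm_num)
      rw [pow_one] at this
      linarith
  · obtain ⟨t, ht, h⟩ := tiltedPath_eq ΔB D (1 / q ^ 4) (q ^ 10) (q ^ 6) hε hs
    rw [h]
    refine (opNorm_HC'_le hε (by positivity) (by positivity) hε ht (hR t ht)).trans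
      (total_norm_le hp1 hqp (by linarith) hℓp)
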